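/- All Hilbert spaces are complex and finite-dimensional, and $\mathcal L(\mathcal H)$ is the algebra of linear operators on $\mathcal H$. A von Neumann algebra on $\mathcal H$ is a unital $*$-subalgebra $\mathcal A\subseteq\mathcal L(\mathcal H)$; $\mathcal A'$ is its commutant, and $\mathcal Z(\mathcal A)=\mathcal A\cap\mathcal A'$ its centre. A channel is a completely positive trace-preserving (CPTP) linear map. **Partial trace over an algebra.** Let $\mathcal A$ be a von Neumann algebra on $\mathcal H$ and let $U:\mathcal H\to\bigoplus_i \mathcal H_L^i\otimes\mathcal H_R^i$ be a unitary, with finitely many non-zero spaces $\mathcal H_L^i,\mathcal H_R^i$, such that $U\mathcal A U^\dagger=\bigoplus_i\mathcal L(\mathcal H_L^i)\otimes\mathbb 1$. Identifying $\mathcal H$ with the direct sum by means of $U$ and writing $\pi_i$ for the projector on the $i$-th summand, put $$\mathrm{Tr}_{\mathcal A'}:\mathcal L(\mathcal H)\to\bigoplus_i\mathcal L(\mathcal H_L^i),\qquad \mathrm{Tr}_{\mathcal A'}(\rho)=\bigoplus_i\mathrm{Tr}_{\mathcal H_R^i}(\pi_i\rho\pi_i).$$ It depends on $U$ only up to unitaries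 on the spaces $\mathcal H_L^i$ and the numbering of the summands. **Semi-causality.** Let $\mathcal A\subseteq\mathcal L(\mathcal H)$ and $\mathcal B\subseteq\mathcal L(\mathcal K)$ be von Neumann algebras. A channel $\mathcal E:\mathcal L(\mathcal H)\to\mathcal L(\mathcal K)$ is (Schrödinger) semi-causal from $\mathcal A$ to $\mathcal B$ if there is a CPTP map $\mathcal E'$ between the direct sums of operator algebras in which the two traces take their values, such that $\mathrm{Tr}_{\mathcal B'}\circ\mathcal E=\mathcal E'\circ\mathrm{Tr}_{\mathcal A}$. **Splitting maps.** A splitting map on $\mathcal H$ is an isometry $\chi:\mathcal H\to\mathcal H_L^\chi\otimes\mathcal H_R^\chi$ for some Hilbert spaces $\mathcal H_L^\chi,\mathcal H_R^\chi$. Let $\pi^\chi=\chi\chi^\dagger$ and $$\mathrm{Cons}_L(\chi)=\{B\in\mathcal L(\mathcal H_L^\chi):\pi^\chi(B\otimes\mathbb 1)=(B\otimes\mathbb 1)\pi^\chi\},$$ $$\mathrm{StLoc}_L(\chi)=\{A\in\mathcal L(\mathcal H):\exists B\in\mathcal L(\mathcal H_L^\chi),\ A\chi^\dagger=\chi^\dagger(B\otimes\mathbb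 1)\text{ and }\chi A=(B\otimes\mathbb 1)\chi\},$$ and define $\mathrm{Cons}_R(\chi)$ and $\mathrm{StLoc}_R(\chi)$ in the same way with $B\in\mathcal L(\mathcal H_R^\chi)$ and $\mathbb 1\otimes B$. The map $\chi$ represents the algebra $\mathrm{StLoc}_L(\chi)$. It is balanced if $\mathrm{StLoc}_R(\chi)=\mathrm{StLoc}_L(\chi)'$, and lean if it is balanced, $\mathrm{Cons}_L(\chi)'=\mathcal Z(\mathrm{Cons}_L(\chi))$ and $\mathrm{Cons}_R(\chi)'=\mathcal Z(\mathrm{Cons}_R(\chi))$. **Semi-localisability.** A channel $\mathcal E:\mathcal L(\mathcal H)\to\mathcal L(\mathcal K)$ is semi-localisable from a splitting map $\chi$ on $\mathcal H$ to a splitting map $\zeta$ on $\mathcal K$ if there are a Hilbert space $\mathcal H_M$ and channels $\mathcal E_1:\mathcal L(\mathcal H_L^\chi)\to\mathcal L(\mathcal H_L^\zeta\otimes\mathcal H_M)$ and $\mathcal E_2:\mathcal L(\mathcal H_M\otimes\mathcal H_R^\chi)\to\mathcal L(\mathcal H_R^\zeta)$ such that $\mathcal F=(\mathrm{id}\otimes\mathcal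 E_2)\circ(\mathcal E_1\otimes\mathrm{id})$ satisfies, for all $\rho\in\mathcal L(\mathcal H)$, $$\mathcal E(\rho)=\zeta^\dagger\,\mathcal F(\chi\rho\chi^\dagger)\,\zeta\qquad\text{and}\qquad\pi^\zeta\,\mathcal F(\chi\rho\chi^\dagger)\,\pi^\zeta=\mathcal F(\chi\rho\chi^\dagger).$$ **Theorem.** Let $\mathcal H,\mathcal K$ be finite-dimensional Hilbert spaces, $\mathcal A\subseteq\mathcal L(\mathcal H)$ and $\mathcal B\subseteq\mathcal L(\mathcal K)$ von Neumann algebras, and $\mathcal E:\mathcal L(\mathcal H)\to\mathcal L(\mathcal K)$ a channel. Then $\mathcal E$ is semi-causal from $\mathcal A$ to $\mathcal B$ if and only if there exist lean splitting maps $\chi_{\mathcal A'}$ on $\mathcal H$ and $\chi_{\mathcal B}$ on $\mathcal K$, representing $\mathcal A'$ and $\mathcal B$ respectively, such that $\mathcal E$ is semi-localisable from $\chi_{\mathcal A'}$ to $\chi_{\mathcal B}$. -/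

import Mathlib

open scoped TensorProduct ComplexOrder

noncomputable section

namespace SplittingMaps

universe u v w

/-! ### Super-operators and channels

Throughout, Hilbert spaces are finite-dimensional complex inner product spaces and the algebra
`𝓛(H)` of operators on `H` is `H →ₗ[ℂ] H`, with the adjoint as involution. -/

section Channels

variable {H : Type u} [NormedAddCommGroup H] [InnerProductSpace ℂ H] [FiniteDimensional ℂ H]
  {K : Type v} [NormedAddCommGroup K] [InnerProductSpace ℂ K] [FiniteDimensional ℂ K]

/-- Positivity of a `k × k` matrix of operators on `H`, seen as an operator on `H ⊕ ⋯ ⊕ H`. -/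
def BlockPositive {k : ℕ} (T : Matrix (Fin k) (Fin k) (H →ₗ[ℂ] H)) : Prop :=
  ∀ x : Fin k → H, 0 ≤ ∑ a, ∑ b, inner ℂ (x a) (T a b (x b))

/-- Complete positivity of a linear map `𝓛(H) → 𝓛(K)`: all its amplifications to matrices of
operators are positive. -/
def IsCompletelyPositive (E : (H →ₗ[ℂ] H) →ₗ[ℂ] (K →ₗ[ℂ] K)) : Prop :=
  ∀ (k : ℕ) (T : Matrix (Fin k) (Fin k) (H →ₗ[ℂ] H)), BlockPositive T → BlockPositive (T.map E)

/-- A quantum channel `𝓛(H) → 𝓛(K)`: a completely positive trace-preserving linear map. -/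
structure IsChannel (E : (H →ₗ[ℂ] H) →ₗ[ℂ] (K →ₗ[ℂ] K)) : Prop where
  completelyPositive : IsCompletelyPositive E
  trace_preserving : ∀ ρ : H →ₗ[ℂ] H, LinearMap.trace ℂ K (E ρ) = LinearMap.trace ℂ H ρ

/-- Conjugation `ρ ↦ V ρ V†` by a linear map `V : H → K`. -/
def conj (V : H →ₗ[ℂ] K) : (H →ₗ[ℂ] H) →ₗ[ℂ] (K →ₗ[ℂ] K) where
  toFun ρ := V ∘ₗ ρ ∘ₗ LinearMap.adjoint V
  map_add' ρ σ := by simp [LinearMap.add_comp, LinearMap.comp_add]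
  map_smul' c ρ := by simp [LinearMap.smul_comp, LinearMap.comp_smul]

end Channels

section DirectSums

variable {I : Type} [Fintype I] {H : I → Type u} [∀ i, NormedAddCommGroup (H i)]
  [∀ i, InnerProductSpace ℂ (H i)] [∀ i, FiniteDimensional ℂ (H i)]
  {J : Type} [Fintype J] {K : J → Type v} [∀ j, NormedAddCommGroup (K j)]
  [∀ j, InnerProductSpace ℂ (K j)] [∀ j, FiniteDimensional ℂ (K j)]

/-- A completely positive trace-preserving map `⨁ᵢ 𝓛(Hᵢ) → ⨁ⱼ 𝓛(Kⱼ)`. Positivity in a direct sum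
is positivity of every component, and the trace is the sum of the traces of the components. -/
structure IsDirectSumChannel
    (E : (∀ i, H i →ₗ[ℂ] H i) →ₗ[ℂ] (∀ j, K j →ₗ[ℂ] K j)) : Prop where
  completelyPositive :
    ∀ (k : ℕ) (T : Matrix (Fin k) (Fin k) (∀ i, H i →ₗ[ℂ] H i)),
      (∀ i, BlockPositive (T.map fun t => t i)) → ∀ j, BlockPositive (T.map fun t => E t j)
  trace_preserving :
    ∀ ρ : ∀ i, H i →ₗ[ℂ] H i,
      ∑ j, LinearMap.trace ℂ (K j) (E ρ j) = ∑ i, LinearMap.trace ℂ (H i) (ρ i)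

end DirectSums

section Tensor

variable {H : Type u} [NormedAddCommGroup H] [InnerProductSpace ℂ H] [FiniteDimensional ℂ H]
  {K : Type v} [NormedAddCommGroup K] [InnerProductSpace ℂ K] [FiniteDimensional ℂ K]
  {S : Type w} [NormedAddCommGroup S] [InnerProductSpace ℂ S] [FiniteDimensional ℂ S]

/-- The partial trace `𝓛(H ⊗ S) → 𝓛(H)` over the right factor: the linear map with
`A ⊗ B ↦ Tr(B) A`. -/
def traceRight : ((H ⊗[ℂ] S) →ₗ[ℂ] (H ⊗[ℂ] S)) →ₗ[ℂ] (H →ₗ[ℂ] H) :=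
  (TensorProduct.rid ℂ (H →ₗ[ℂ] H)).toLinearMap ∘ₗ
    LinearMap.lTensor (H →ₗ[ℂ] H) (LinearMap.trace ℂ S) ∘ₗ
      (homTensorHomEquiv ℂ H S H S).symm.toLinearMap

/-- The super-operator `E ⊗ id : 𝓛(H ⊗ S) → 𝓛(K ⊗ S)`, with `A ⊗ B ↦ E(A) ⊗ B`. -/
def actLeft (S : Type w) [NormedAddCommGroup S] [InnerProductSpace ℂ S] [FiniteDimensional ℂ S]
    (E : (H →ₗ[ℂ] H) →ₗ[ℂ] (K →ₗ[ℂ] K)) :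
    ((H ⊗[ℂ] S) →ₗ[ℂ] (H ⊗[ℂ] S)) →ₗ[ℂ] ((K ⊗[ℂ] S) →ₗ[ℂ] (K ⊗[ℂ] S)) :=
  (homTensorHomEquiv ℂ K S K S).toLinearMap ∘ₗ
    LinearMap.rTensor (S →ₗ[ℂ] S) E ∘ₗ (homTensorHomEquiv ℂ H S H S).symm.toLinearMap

/-- The super-operator `id ⊗ E : 𝓛(S ⊗ H) → 𝓛(S ⊗ K)`, with `B ⊗ A ↦ B ⊗ E(A)`. -/
def actRight (S : Type w) [NormedAddCommGroup S] [InnerProductSpace ℂ S] [FiniteDimensional ℂ S]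
    (E : (H →ₗ[ℂ] H) →ₗ[ℂ] (K →ₗ[ℂ] K)) :
    ((S ⊗[ℂ] H) →ₗ[ℂ] (S ⊗[ℂ] H)) →ₗ[ℂ] ((S ⊗[ℂ] K) →ₗ[ℂ] (S ⊗[ℂ] K)) :=
  (homTensorHomEquiv ℂ S K S K).toLinearMap ∘ₗ
    LinearMap.lTensor (S →ₗ[ℂ] S) E ∘ₗ (homTensorHomEquiv ℂ S H S H).symm.toLinearMap

end Tensor

/-! ### The partial trace over a von Neumann algebra

In finite dimension a von Neumann algebra on `H` is a unital *-subalgebra of `𝓛(H)`. -/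

section Algebras

variable {H : Type u} [NormedAddCommGroup H] [InnerProductSpace ℂ H] [FiniteDimensional ℂ H]
  {K : Type v} [NormedAddCommGroup K] [InnerProductSpace ℂ K] [FiniteDimensional ℂ K]

/-- The commutant of a *-subalgebra of `𝓛(H)`. -/
def commutant (A : StarSubalgebra ℂ (H →ₗ[ℂ] H)) : StarSubalgebra ℂ (H →ₗ[ℂ] H) :=
  StarSubalgebra.centralizer ℂ (A : Set (H →ₗ[ℂ] H))

/-- `U : H → ⨁ᵢ Lᵢ ⊗ Rᵢ` is a representation unitary of the algebra `A`, that is,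
`U A U† = ⨁ᵢ 𝓛(Lᵢ) ⊗ 1`. -/
def IsRepresentationUnitary {n : ℕ} {L R : Fin n → Type}
    [∀ i, NormedAddCommGroup (L i)] [∀ i, InnerProductSpace ℂ (L i)]
    [∀ i, NormedAddCommGroup (R i)] [∀ i, InnerProductSpace ℂ (R i)]
    (A : StarSubalgebra ℂ (H →ₗ[ℂ] H)) (U : H ≃ₗᵢ[ℂ] PiLp 2 (fun i => L i ⊗[ℂ] R i)) : Prop :=
  ∀ a : H →ₗ[ℂ] H,
    a ∈ A ↔ ∃ b : ∀ i, L i →ₗ[ℂ] L i, ∀ x i, U (a x) i = LinearMap.rTensor (R i) (b i) (U x i)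

/-- The restriction to the `i`-th block `Lᵢ ⊗ Rᵢ` of `πᵢ (U ρ U†) πᵢ`, where `πᵢ` is the
projector on that block. -/
def block {n : ℕ} {L R : Fin n → Type}
    [∀ i, NormedAddCommGroup (L i)] [∀ i, InnerProductSpace ℂ (L i)]
    [∀ i, NormedAddCommGroup (R i)] [∀ i, InnerProductSpace ℂ (R i)]
    (U : H ≃ₗᵢ[ℂ] PiLp 2 (fun i => L i ⊗[ℂ] R i)) (i : Fin n) :
    (H →ₗ[ℂ] H) →ₗ[ℂ] ((L i ⊗[ℂ] R i) →ₗ[ℂ] (L i ⊗[ℂ] R i)) where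
  toFun ρ := PiLp.projₗ 2 (fun i => L i ⊗[ℂ] R i) i ∘ₗ
    U.toLinearEquiv.toLinearMap ∘ₗ ρ ∘ₗ U.symm.toLinearEquiv.toLinearMap ∘ₗ
      (WithLp.linearEquiv 2 ℂ (∀ i, L i ⊗[ℂ] R i)).symm.toLinearMap ∘ₗ
        LinearMap.single ℂ (fun i => L i ⊗[ℂ] R i) i
  map_add' ρ σ := by simp [LinearMap.add_comp, LinearMap.comp_add]
  map_smul' c ρ := by simp [LinearMap.smul_comp, LinearMap.comp_smul]

/-- For a representation unitary `U : H → ⨁ᵢ Lᵢ ⊗ Rᵢ` of `A`, the partial trace over the commutant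
of `A`, namely the map `𝓛(H) → ⨁ᵢ 𝓛(Lᵢ)` with `ρ ↦ ⨁ᵢ Tr_{Rᵢ}(πᵢ ρ πᵢ)`, where `H` is identified
with `⨁ᵢ Lᵢ ⊗ Rᵢ` by means of `U`. -/
def traceCommutant {n : ℕ} {L R : Fin n → Type}
    [∀ i, NormedAddCommGroup (L i)] [∀ i, InnerProductSpace ℂ (L i)]
    [∀ i, FiniteDimensional ℂ (L i)]
    [∀ i, NormedAddCommGroup (R i)] [∀ i, InnerProductSpace ℂ (R i)]
    [∀ i, FiniteDimensional ℂ (R i)]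
    (U : H ≃ₗᵢ[ℂ] PiLp 2 (fun i => L i ⊗[ℂ] R i)) :
    (H →ₗ[ℂ] H) →ₗ[ℂ] (∀ i, L i →ₗ[ℂ] L i) :=
  LinearMap.pi fun i => traceRight ∘ₗ block U i

/-- A representation unitary of the algebra `A`, with its Hilbert spaces, all of them non-zero. -/
structure RepresentationUnitary (A : StarSubalgebra ℂ (H →ₗ[ℂ] H)) where
  /-- the number of blocks -/
  blocks : ℕ
  /-- the left Hilbert spaces -/
  L : Fin blocks → Type
  /-- the right Hilbert spaces -/
  R : Fin blocks → Type
  [normedL : ∀ i, NormedAddCommGroup (L i)]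
  [innerL : ∀ i, InnerProductSpace ℂ (L i)]
  [finiteL : ∀ i, FiniteDimensional ℂ (L i)]
  [nontrivialL : ∀ i, Nontrivial (L i)]
  [normedR : ∀ i, NormedAddCommGroup (R i)]
  [innerR : ∀ i, InnerProductSpace ℂ (R i)]
  [finiteR : ∀ i, FiniteDimensional ℂ (R i)]
  [nontrivialR : ∀ i, Nontrivial (R i)]
  /-- the unitary -/
  U : H ≃ₗᵢ[ℂ] PiLp 2 (fun i => L i ⊗[ℂ] R i)
  isRepresentation : IsRepresentationUnitary A U

attribute [instance] RepresentationUnitary.normedL RepresentationUnitary.innerL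
  RepresentationUnitary.finiteL RepresentationUnitary.nontrivialL
  RepresentationUnitary.normedR RepresentationUnitary.innerR
  RepresentationUnitary.finiteR RepresentationUnitary.nontrivialR

/-- Schrödinger semi-causality from `A` to `B`: there is a completely positive trace-preserving
`E'` with `Tr_{B'} ∘ E = E' ∘ Tr_A`. The trace over `A = (A')'` is computed from a representation
unitary of `A'`, the trace over `B'` from a representation unitary of `B`. Two representation
unitaries of the same algebra differ only by unitaries on the spaces `Lᵢ` and `Rᵢ` and by the
numbering of the blocks, so it does not matter which ones are taken. -/
def IsSemiCausal (E : (H →ₗ[ℂ] H) →ₗ[ℂ] (K →ₗ[ℂ] K))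
    (A : StarSubalgebra ℂ (H →ₗ[ℂ] H)) (B : StarSubalgebra ℂ (K →ₗ[ℂ] K)) : Prop :=
  ∃ (r : RepresentationUnitary (commutant A)) (s : RepresentationUnitary B)
    (E' : (∀ i, r.L i →ₗ[ℂ] r.L i) →ₗ[ℂ] (∀ j, s.L j →ₗ[ℂ] s.L j)),
    IsDirectSumChannel E' ∧ traceCommutant s.U ∘ₗ E = E' ∘ₗ traceCommutant r.U

end Algebras

/-! ### Splitting maps

A splitting map on `H` is an isometry `χ : H → L ⊗ R`. -/

section Splitting

variable {H : Type u} [NormedAddCommGroup H] [InnerProductSpace ℂ H] [FiniteDimensional ℂ H]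
  {L : Type v} [NormedAddCommGroup L] [InnerProductSpace ℂ L] [FiniteDimensional ℂ L]
  {R : Type w} [NormedAddCommGroup R] [InnerProductSpace ℂ R] [FiniteDimensional ℂ R]

/-- The adjoint `χ†` of a splitting map. -/
def dagger (χ : H →ₗᵢ[ℂ] L ⊗[ℂ] R) : L ⊗[ℂ] R →ₗ[ℂ] H := LinearMap.adjoint χ.toLinearMap

/-- The orthogonal projector `χ χ†` on the image of `χ`. -/
def imageProj (χ : H →ₗᵢ[ℂ] L ⊗[ℂ] R) : L ⊗[ℂ] R →ₗ[ℂ] L ⊗[ℂ] R := χ.toLinearMap ∘ₗ dagger χ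

/-- The left-consistent operators: `B ∈ 𝓛(L)` such that `B ⊗ 1` commutes with `χ χ†`. -/
def consL (χ : H →ₗᵢ[ℂ] L ⊗[ℂ] R) : Set (L →ₗ[ℂ] L) :=
  {B | imageProj χ ∘ₗ LinearMap.rTensor R B = LinearMap.rTensor R B ∘ₗ imageProj χ}

/-- The right-consistent operators: `B ∈ 𝓛(R)` such that `1 ⊗ B` commutes with `χ χ†`. -/
def consR (χ : H →ₗᵢ[ℂ] L ⊗[ℂ] R) : Set (R →ₗ[ℂ] R) :=
  {B | imageProj χ ∘ₗ LinearMap.lTensor L B = LinearMap.lTensor L B ∘ₗ imageProj χ}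

/-- The strictly left-local operators: those `A` for which there is `B ∈ 𝓛(L)` with
`A χ† = χ† (B ⊗ 1)` and `χ A = (B ⊗ 1) χ`. -/
def stlocL (χ : H →ₗᵢ[ℂ] L ⊗[ℂ] R) : Set (H →ₗ[ℂ] H) :=
  {A | ∃ B : L →ₗ[ℂ] L, A ∘ₗ dagger χ = dagger χ ∘ₗ LinearMap.rTensor R B ∧
    χ.toLinearMap ∘ₗ A = LinearMap.rTensor R B ∘ₗ χ.toLinearMap}

/-- The strictly right-local operators: those `A` for which there is `B ∈ 𝓛(R)` with
`A χ† = χ† (1 ⊗ B)` and `χ A = (1 ⊗ B) χ`. -/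
def stlocR (χ : H →ₗᵢ[ℂ] L ⊗[ℂ] R) : Set (H →ₗ[ℂ] H) :=
  {A | ∃ B : R →ₗ[ℂ] R, A ∘ₗ dagger χ = dagger χ ∘ₗ LinearMap.lTensor L B ∧
    χ.toLinearMap ∘ₗ A = LinearMap.lTensor L B ∘ₗ χ.toLinearMap}

/-- A splitting map is balanced if its strictly right-local operators form the commutant of its
strictly left-local operators. -/
def IsBalanced (χ : H →ₗᵢ[ℂ] L ⊗[ℂ] R) : Prop := stlocR χ = Set.centralizer (stlocL χ)

/-- A splitting map is lean if it is balanced and the commutant of each of its two algebras of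
consistent operators is equal to the centre of that algebra. -/
structure IsLeanSplitting (χ : H →ₗᵢ[ℂ] L ⊗[ℂ] R) : Prop where
  balanced : IsBalanced χ
  left : Set.centralizer (consL χ) = consL χ ∩ Set.centralizer (consL χ)
  right : Set.centralizer (consR χ) = consR χ ∩ Set.centralizer (consR χ)

/-- A splitting map represents the algebra of its strictly left-local operators. -/
def Represents (χ : H →ₗᵢ[ℂ] L ⊗[ℂ] R) (A : StarSubalgebra ℂ (H →ₗ[ℂ] H)) : Prop :=
  stlocL χ = (A : Set (H →ₗ[ℂ] H))

/-- A splitting map on `H` together with its two Hilbert spaces. -/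
structure SplittingMap (H : Type u) [NormedAddCommGroup H] [InnerProductSpace ℂ H] where
  /-- the left Hilbert space -/
  L : Type
  /-- the right Hilbert space -/
  R : Type
  [normedL : NormedAddCommGroup L]
  [innerL : InnerProductSpace ℂ L]
  [finiteL : FiniteDimensional ℂ L]
  [normedR : NormedAddCommGroup R]
  [innerR : InnerProductSpace ℂ R]
  [finiteR : FiniteDimensional ℂ R]
  /-- the isometry -/
  map : H →ₗᵢ[ℂ] L ⊗[ℂ] R

attribute [instance] SplittingMap.normedL SplittingMap.innerL SplittingMap.finiteL
  SplittingMap.normedR SplittingMap.innerR SplittingMap.finiteR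

end Splitting

/-! ### Semi-localisability -/

section SemiLocalisability

variable {H : Type u} [NormedAddCommGroup H] [InnerProductSpace ℂ H] [FiniteDimensional ℂ H]
  {K : Type v} [NormedAddCommGroup K] [InnerProductSpace ℂ K] [FiniteDimensional ℂ K]
  {L R L' R' M : Type}
  [NormedAddCommGroup L] [InnerProductSpace ℂ L] [FiniteDimensional ℂ L]
  [NormedAddCommGroup R] [InnerProductSpace ℂ R] [FiniteDimensional ℂ R]
  [NormedAddCommGroup L'] [InnerProductSpace ℂ L'] [FiniteDimensional ℂ L']
  [NormedAddCommGroup R'] [InnerProductSpace ℂ R'] [FiniteDimensional ℂ R']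
  [NormedAddCommGroup M] [InnerProductSpace ℂ M] [FiniteDimensional ℂ M]

/-- The super-operator `(id ⊗ E₂) ∘ (E₁ ⊗ id)`, which acts first with `E₁ : 𝓛(L) → 𝓛(L' ⊗ M)` on
the left factor of `L ⊗ R` and then with `E₂ : 𝓛(M ⊗ R) → 𝓛(R')` on the right factors. -/
def sequential
    (E₁ : (L →ₗ[ℂ] L) →ₗ[ℂ] ((L' ⊗[ℂ] M) →ₗ[ℂ] (L' ⊗[ℂ] M)))
    (E₂ : ((M ⊗[ℂ] R) →ₗ[ℂ] (M ⊗[ℂ] R)) →ₗ[ℂ] (R' →ₗ[ℂ] R')) :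
    ((L ⊗[ℂ] R) →ₗ[ℂ] (L ⊗[ℂ] R)) →ₗ[ℂ] ((L' ⊗[ℂ] R') →ₗ[ℂ] (L' ⊗[ℂ] R')) :=
  actRight L' E₂ ∘ₗ (TensorProduct.assoc ℂ L' M R).conj.toLinearMap ∘ₗ actLeft R E₁

/-- Semi-localisability of `E` from `χ` to `ζ`: for some channels `E₁`, `E₂`, with
`F = (id ⊗ E₂) ∘ (E₁ ⊗ id)`, one has `E(ρ) = ζ† F(χ ρ χ†) ζ` for all `ρ`, and `F(χ ρ χ†)` is
unchanged by the projector on the image of `ζ`, that is, `ζζ† F(χ ρ χ†) ζζ† = F(χ ρ χ†)`. -/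
def IsSemiLocalisable (E : (H →ₗ[ℂ] H) →ₗ[ℂ] (K →ₗ[ℂ] K))
    (χ : H →ₗᵢ[ℂ] L ⊗[ℂ] R) (ζ : K →ₗᵢ[ℂ] L' ⊗[ℂ] R') : Prop :=
  ∃ (M : Type) (_ : NormedAddCommGroup M) (_ : InnerProductSpace ℂ M)
    (_ : FiniteDimensional ℂ M)
    (E₁ : (L →ₗ[ℂ] L) →ₗ[ℂ] ((L' ⊗[ℂ] M) →ₗ[ℂ] (L' ⊗[ℂ] M)))
    (E₂ : ((M ⊗[ℂ] R) →ₗ[ℂ] (M ⊗[ℂ] R)) →ₗ[ℂ] (R' →ₗ[ℂ] R')),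
    IsChannel E₁ ∧ IsChannel E₂ ∧
    E = conj (dagger ζ) ∘ₗ sequential E₁ E₂ ∘ₗ conj χ.toLinearMap ∧
    conj (imageProj ζ) ∘ₗ sequential E₁ E₂ ∘ₗ conj χ.toLinearMap =
      sequential E₁ E₂ ∘ₗ conj χ.toLinearMap

end SemiLocalisability

end SplittingMaps

end

/-!
# Semi-causal channels are semi-localisable

A channel `E : 𝓛(H) → 𝓛(K)` is semi-causal from `A` to `B` exactly when its Heisenberg dual `E†`
maps `B` into `A'`. Indeed `Tr_{B'}(σ)` records the expectation values `tr(b σ)`, `b ∈ B`, and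
`Tr_A(ρ)` records the values `tr(c ρ)`, `c ∈ A'` (`trace_comp_traceCommutant`). Both directions of
the equivalence are proved through this condition.

*From semi-causal to semi-localisable.* A unitary `U : H → ⨁ᵢ Lᵢ ⊗ Rᵢ` with
`U A' U† = ⨁ᵢ 𝓛(Lᵢ) ⊗ 1`, followed by the inclusion into `(⨁ᵢ Lᵢ) ⊗ (⨁ᵢ Rᵢ)`, is a lean splitting
map that represents `A'` (`represents_splitting`, `isLeanSplitting_splitting`); in the same way one
obtains a splitting map `ζ` for `B`. Let `S : H → L' ⊗ M` be the isometry that combines a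
Stinespring dilation of `E` with `ζ`, where `M` holds the environment and the right factor of `ζ`.
Semi-causality implies that `S† (b ⊗ 1) S ∈ A'` for all `b ∈ 𝓛(L')`. The first channel is given
by the isometry `W : l ↦ S U† (l ⊗ rᵢ)`, `l ∈ Lᵢ`, for fixed unit vectors `rᵢ ∈ Rᵢ`. As
`S† (b ⊗ 1) S` acts on the left factors only, the vectors `(⟨k| ⊗ 1) W l ⊗ s` in `M ⊗ R` and
`(⟨k| ⊗ 1) S U† (l ⊗ s)` in `M` have the same Gram matrix (`inner_firstStep_tmul`), so a partial
isometry `T : M ⊗ R → M` maps the former to the latter. The second channel applies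
`T` and then discards the environment (`isSemiLocalisable_of_stinespring`).

*From semi-localisable to semi-causal.* The second channel of a semi-localisation acts on the right
factor and preserves the trace, so the dual of the composition sends `b ⊗ 1` to some `c ⊗ 1`, and
`E†` sends `B` to operators `χ† (c ⊗ 1) χ`. These commute with `StLoc_R(χ)`, which contains `A` as
`χ` is balanced and represents `A'` (`IsSemiLocalisable.exists_trace_comp_eq`). To define the
channel `E'` one needs representation unitaries of `A'` and of `B`; their existence is the structure
theorem for finite-dimensional von Neumann algebras (`nonempty_representationUnitary`). It is
derived from the double commutant theorem (`commutant_commutant`) by a decomposition of the unit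
into minimal projections of the commutant, grouped by equivalence. Finally
`E' = Tr_{B'} ∘ E ∘ σ`, where `σ` is a right inverse of `Tr_A`
(`isSemiCausal_of_exists_trace_comp_eq`).
-/

open scoped TensorProduct ComplexOrder

noncomputable section

namespace SplittingMaps

set_option linter.unusedSectionVars false

/-! ### Operators, traces and rank-one maps -/

section Operators

lemma comp_sum {E F G : Type*} [AddCommMonoid E] [AddCommMonoid F] [AddCommMonoid G] [Module ℂ E]
    [Module ℂ F] [Module ℂ G] {ι : Type*} (s : Finset ι) (f : F →ₗ[ℂ] G) (g : ι → E →ₗ[ℂ] F) :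
    f ∘ₗ (∑ i ∈ s, g i) = ∑ i ∈ s, f ∘ₗ g i := by
  refine LinearMap.ext fun x => ?_
  simp only [LinearMap.comp_apply, LinearMap.sum_apply, map_sum]

lemma sum_comp {E F G : Type*} [AddCommMonoid E] [AddCommMonoid F] [AddCommMonoid G] [Module ℂ E]
    [Module ℂ F] [Module ℂ G] {ι : Type*} (s : Finset ι) (g : ι → F →ₗ[ℂ] G) (f : E →ₗ[ℂ] F) :
    (∑ i ∈ s, g i) ∘ₗ f = ∑ i ∈ s, g i ∘ₗ f := by
  refine LinearMap.ext fun x => ?_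
  simp only [LinearMap.comp_apply, LinearMap.sum_apply]

variable {H : Type*} [NormedAddCommGroup H] [InnerProductSpace ℂ H] [FiniteDimensional ℂ H]
  {K : Type*} [NormedAddCommGroup K] [InnerProductSpace ℂ K] [FiniteDimensional ℂ K]
  {S : Type*} [NormedAddCommGroup S] [InnerProductSpace ℂ S] [FiniteDimensional ℂ S]

/-- The rank-one map `|x⟩⟨y|`. -/
def ketBra (x : K) (y : H) : H →ₗ[ℂ] K := LinearMap.toSpanSingleton ℂ K x ∘ₗ innerₛₗ ℂ y

@[simp] lemma ketBra_apply (x : K) (y z : H) : ketBra x y z = inner ℂ y z • x := rfl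

lemma adjoint_ketBra (x : K) (y : H) : LinearMap.adjoint (ketBra x y) = ketBra y x := by
  symm
  rw [LinearMap.eq_adjoint_iff]
  intro a b
  simp [inner_smul_left, inner_smul_right, mul_comm]

lemma comp_ketBra (f : K →ₗ[ℂ] S) (x : K) (y : H) : f ∘ₗ ketBra x y = ketBra (f x) y := by
  ext z; simp

lemma trace_ketBra (x y : H) : LinearMap.trace ℂ H (ketBra x y) = inner ℂ y x := by
  rw [LinearMap.trace_eq_sum_inner _ (stdOrthonormalBasis ℂ H)]
  simp only [ketBra_apply, inner_smul_right]
  exact OrthonormalBasis.sum_inner_mul_inner _ _ _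

lemma sum_ketBra_self {ι : Type*} [Fintype ι] (b : OrthonormalBasis ι ℂ H) :
    ∑ i, ketBra (b i) (b i) = LinearMap.id := by
  ext z
  simpa using b.sum_repr' z

/-- The trace pairing on operators separates points. -/
lemma eq_of_trace_comp_eq {X Y : H →ₗ[ℂ] H}
    (h : ∀ ρ, LinearMap.trace ℂ H (X ∘ₗ ρ) = LinearMap.trace ℂ H (Y ∘ₗ ρ)) : X = Y := by
  refine LinearMap.ext fun x => ext_inner_left ℂ fun y => ?_
  have := h (ketBra x y)
  rwa [comp_ketBra, comp_ketBra, trace_ketBra, trace_ketBra] at this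

/-- Every linear functional on operators is given by the trace pairing with an operator. -/
lemma exists_trace_comp_eq (φ : (H →ₗ[ℂ] H) →ₗ[ℂ] ℂ) :
    ∃ c : H →ₗ[ℂ] H, ∀ ρ, LinearMap.trace ℂ H (c ∘ₗ ρ) = φ ρ := by
  let Φ : (H →ₗ[ℂ] H) →ₗ[ℂ] Module.Dual ℂ (H →ₗ[ℂ] H) :=
    (LinearMap.mul ℂ (Module.End ℂ H)).compr₂ (LinearMap.trace ℂ H)
  have hΦ : ∀ c ρ, Φ c ρ = LinearMap.trace ℂ H (c ∘ₗ ρ) := fun c ρ => rfl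
  have hinj : Function.Injective Φ := fun X Y hXY =>
    eq_of_trace_comp_eq fun ρ => by rw [← hΦ, ← hΦ, hXY]
  have hsurj := (LinearMap.injective_iff_surjective_of_finrank_eq_finrank
    (Subspace.dual_finrank_eq (K := ℂ) (V := H →ₗ[ℂ] H)).symm).1 hinj
  obtain ⟨c, hc⟩ := hsurj φ
  exact ⟨c, fun ρ => by rw [← hΦ, hc]⟩

/-- The isometry with a given underlying linear map `X` that satisfies `X† X = 1`. -/
def isometryOfAdjoint (X : H →ₗ[ℂ] K) (hX : LinearMap.adjoint X ∘ₗ X = LinearMap.id) :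
    H →ₗᵢ[ℂ] K :=
  X.isometryOfInner fun x y => by
    rw [← LinearMap.adjoint_inner_right, ← LinearMap.comp_apply, hX, LinearMap.id_apply]

lemma adjoint_comp_isometry (V : H →ₗᵢ[ℂ] K) :
    LinearMap.adjoint V.toLinearMap ∘ₗ V.toLinearMap = LinearMap.id := by
  refine LinearMap.ext fun x => ext_inner_left ℂ fun y => ?_
  simp

/-- Two families of vectors with the same Gram matrix are related by a partial isometry `T`. The
operator `G` is the projector on the orthogonal complement of the first family. -/
lemma exists_partialIsometry {κ : Type*} (a : κ → H) (b : κ → K)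
    (h : ∀ k k', inner ℂ (a k) (a k') = inner ℂ (b k) (b k')) :
    ∃ (T : H →ₗ[ℂ] K) (G : H →ₗ[ℂ] H), (∀ k, T (a k) = b k) ∧ (∀ k, G (a k) = 0) ∧
      LinearMap.adjoint T ∘ₗ T + LinearMap.adjoint G ∘ₗ G = LinearMap.id := by
  let P : (κ →₀ ℂ) →ₗ[ℂ] H := Finsupp.linearCombination ℂ a
  let Q : (κ →₀ ℂ) →ₗ[ℂ] K := Finsupp.linearCombination ℂ b
  have hPQ : ∀ z z', inner ℂ (P z) (P z') = inner ℂ (Q z) (Q z') := by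
    intro z z'
    simp only [P, Q, Finsupp.linearCombination_apply, Finsupp.sum, sum_inner, inner_sum,
      inner_smul_left, inner_smul_right, h]
  let S := LinearMap.range P
  obtain ⟨σ, hσ⟩ := P.rangeRestrict.exists_rightInverse_of_surjective P.range_rangeRestrict
  have hσ' : ∀ x : S, P (σ x) = x := fun x => by
    have := congrArg Subtype.val (LinearMap.congr_fun hσ x)
    simpa using this
  let p : H →ₗ[ℂ] S := S.orthogonalProjectionOnto.toLinearMap
  have hp : ∀ x y, inner ℂ ((p x : S) : H) y = inner ℂ x ((p y : S) : H) := fun x y =>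
    S.inner_starProjection_left_eq_right x y
  have hpP : ∀ z, p (P z) = ⟨P z, LinearMap.mem_range_self P z⟩ := fun z =>
    S.orthogonalProjectionOnto_mem_subspace_eq_self ⟨P z, LinearMap.mem_range_self P z⟩
  have hpp : ∀ x, p (p x : H) = p x := fun x =>
    S.orthogonalProjectionOnto_mem_subspace_eq_self (p x)
  refine ⟨Q ∘ₗ σ ∘ₗ p, LinearMap.id - S.subtype ∘ₗ p, fun k => ?_, fun k => ?_, ?_⟩
  · have hk : a k = P (Finsupp.single k 1) := by simp [P]
    have hk' : b k = Q (Finsupp.single k 1) := by simp [Q]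
    rw [hk, hk', LinearMap.comp_apply, LinearMap.comp_apply, hpP, ← sub_eq_zero, ← map_sub,
      ← inner_self_eq_zero (𝕜 := ℂ), ← hPQ, map_sub, hσ', sub_self, inner_zero_left]
  · have hk : a k = P (Finsupp.single k 1) := by simp [P]
    simp [hk, hpP]
  · refine LinearMap.ext fun x => ext_inner_left ℂ fun y => ?_
    simp only [LinearMap.add_apply, LinearMap.comp_apply, LinearMap.adjoint_inner_right,
      inner_add_right, LinearMap.sub_apply, LinearMap.id_apply, Submodule.subtype_apply, ← hPQ,
      hσ', inner_sub_left, inner_sub_right]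
    rw [hp, hp, hpp]
    ring

end Operators

/-! ### Completely positive maps and Kraus operators -/

section Kraus

variable {H : Type*} [NormedAddCommGroup H] [InnerProductSpace ℂ H] [FiniteDimensional ℂ H]
  {K : Type*} [NormedAddCommGroup K] [InnerProductSpace ℂ K] [FiniteDimensional ℂ K]
  {S : Type*} [NormedAddCommGroup S] [InnerProductSpace ℂ S] [FiniteDimensional ℂ S]

lemma conj_apply (V : H →ₗ[ℂ] K) (ρ : H →ₗ[ℂ] H) :
    conj V ρ = V ∘ₗ ρ ∘ₗ LinearMap.adjoint V := rfl

lemma conj_comp (W : K →ₗ[ℂ] S) (V : H →ₗ[ℂ] K) : conj W ∘ₗ conj V = conj (W ∘ₗ V) := by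
  ext ρ : 1
  simp [conj_apply, LinearMap.adjoint_comp, LinearMap.comp_assoc]

lemma conj_conj (W : K →ₗ[ℂ] S) (V : H →ₗ[ℂ] K) (ρ : H →ₗ[ℂ] H) :
    conj W (conj V ρ) = conj (W ∘ₗ V) ρ := LinearMap.congr_fun (conj_comp W V) ρ

lemma trace_conj (V : H →ₗ[ℂ] K) (X : K →ₗ[ℂ] K) (ρ : H →ₗ[ℂ] H) :
    LinearMap.trace ℂ K (X ∘ₗ conj V ρ) =
      LinearMap.trace ℂ H ((LinearMap.adjoint V ∘ₗ X ∘ₗ V) ∘ₗ ρ) := by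
  rw [conj_apply, ← LinearMap.comp_assoc, ← LinearMap.comp_assoc, LinearMap.trace_comp_comm']
  simp [LinearMap.comp_assoc]

lemma BlockPositive.sum {k : ℕ} {ι : Type*} (s : Finset ι)
    {T : ι → Matrix (Fin k) (Fin k) (H →ₗ[ℂ] H)} (hT : ∀ i ∈ s, BlockPositive (T i)) :
    BlockPositive (∑ i ∈ s, T i) := by
  intro x
  have : ∑ a, ∑ b, inner ℂ (x a) ((∑ i ∈ s, T i) a b (x b)) =
      ∑ i ∈ s, ∑ a, ∑ b, inner ℂ (x a) (T i a b (x b)) := by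
    simp only [Matrix.sum_apply, LinearMap.sum_apply, inner_sum]
    rw [Finset.sum_comm]
    conv_rhs => rw [Finset.sum_comm]
    conv_lhs => rw [Finset.sum_comm]
    exact Finset.sum_congr rfl fun a _ => Finset.sum_comm
  rw [this]
  exact Finset.sum_nonneg fun i hi => hT i hi x

lemma BlockPositive.conj {k : ℕ} {T : Matrix (Fin k) (Fin k) (H →ₗ[ℂ] H)} (hT : BlockPositive T)
    (V : H →ₗ[ℂ] K) : BlockPositive (T.map (conj V)) := by
  intro x
  simpa [conj_apply, LinearMap.adjoint_inner_left] using hT fun a => LinearMap.adjoint V (x a)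

lemma isCompletelyPositive_sum_conj {ι : Type*} [Fintype ι] (V : ι → H →ₗ[ℂ] K) :
    IsCompletelyPositive (∑ i, conj (V i)) := by
  intro k T hT
  have : T.map ⇑(∑ i, SplittingMaps.conj (V i)) = ∑ i, T.map (SplittingMaps.conj (V i)) := by
    ext a b : 2
    simp [Matrix.sum_apply]
  rw [this]
  exact BlockPositive.sum _ fun i _ => hT.conj (V i)

lemma trace_sum_conj {ι : Type*} [Fintype ι] (V : ι → H →ₗ[ℂ] K) (X : K →ₗ[ℂ] K)
    (ρ : H →ₗ[ℂ] H) :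
    LinearMap.trace ℂ K (X ∘ₗ (∑ i, conj (V i)) ρ) =
      LinearMap.trace ℂ H ((∑ i, LinearMap.adjoint (V i) ∘ₗ X ∘ₗ V i) ∘ₗ ρ) := by
  simp [comp_sum, sum_comp, trace_conj]

lemma isChannel_sum_conj {ι : Type*} [Fintype ι] {V : ι → H →ₗ[ℂ] K}
    (hV : ∑ i, LinearMap.adjoint (V i) ∘ₗ V i = LinearMap.id) : IsChannel (∑ i, conj (V i)) where
  completelyPositive := isCompletelyPositive_sum_conj V
  trace_preserving ρ := by
    have := trace_sum_conj V LinearMap.id ρ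
    simpa [hV] using this

/-- The block matrix of the matrix units of a family of vectors is positive. -/
lemma blockPositive_ketBra {k : ℕ} (h : Fin k → H) :
    BlockPositive (Matrix.of fun a b => ketBra (h a) (h b)) := by
  intro x
  have : ∑ a, ∑ b, inner ℂ (x a) (Matrix.of (fun a b => ketBra (h a) (h b)) a b (x b)) =
      star (∑ a, inner ℂ (h a) (x a)) * ∑ b, inner ℂ (h b) (x b) := by
    rw [star_sum, Finset.sum_mul_sum]
    refine Finset.sum_congr rfl fun a _ => Finset.sum_congr rfl fun b _ => ?_
    simp [mul_comm]
  rw [this]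
  exact star_mul_self_nonneg _

open scoped MatrixOrder Matrix.Norms.L2Operator in
/-- A complex matrix with nonnegative quadratic form is a Gram matrix. -/
lemma exists_conjTranspose_mul_self {ι : Type*} [Fintype ι] [DecidableEq ι] (C : Matrix ι ι ℂ)
    (hC : ∀ x : ι → ℂ, 0 ≤ ∑ i, ∑ j, star (x i) * C i j * x j) :
    ∃ X : Matrix ι ι ℂ, C = X.conjTranspose * X := by
  have hC' : ∀ x : ι → ℂ, 0 ≤ star x ⬝ᵥ C.mulVec x := by
    intro x
    convert hC x using 1
    simp [dotProduct, Matrix.mulVec, Finset.mul_sum, mul_assoc]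
  have hpos : C.PosSemidef := by
    refine Matrix.PosSemidef.of_dotProduct_mulVec_nonneg ?_ hC'
    rw [← Matrix.isSymmetric_toEuclideanLin_iff, LinearMap.isSymmetric_iff_inner_map_self_real]
    intro v
    have h := hC' v.ofLp
    have h2 : inner ℂ (C.toEuclideanLin v) v = star (star v.ofLp ⬝ᵥ C.mulVec v.ofLp) := by
      rw [← inner_conj_symm, EuclideanSpace.inner_eq_star_dotProduct]
      simp [Matrix.toEuclideanLin, dotProduct_comm]
    rw [h2]
    have h3 := (IsSelfAdjoint.of_nonneg h).star_eq
    rw [h3]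
    exact h3
  obtain ⟨X, hX⟩ := CStarAlgebra.nonneg_iff_eq_star_mul_self.mp hpos.nonneg
  exact ⟨X, hX⟩

/-- Kraus decomposition: by positivity of the amplification of `E` at the matrix units of an
orthonormal basis, the Choi matrix of `E` is a Gram matrix `X† X`; the rows of `X` are the Kraus
operators. -/
lemma IsCompletelyPositive.exists_kraus {E : (H →ₗ[ℂ] H) →ₗ[ℂ] (K →ₗ[ℂ] K)}
    (hE : IsCompletelyPositive E) :
    ∃ (N : ℕ) (V : Fin N → H →ₗ[ℂ] K), E = ∑ e, conj (V e) := by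
  let h := stdOrthonormalBasis ℂ H
  let κ := stdOrthonormalBasis ℂ K
  let ι := Fin (Module.finrank ℂ H) × Fin (Module.finrank ℂ K)
  let C : Matrix ι ι ℂ := Matrix.of fun i j => inner ℂ (κ i.2) (E (ketBra (h i.1) (h j.1)) (κ j.2))
  obtain ⟨X, hX⟩ := exists_conjTranspose_mul_self C fun x => by
    have := hE _ _ (blockPositive_ketBra h) fun a => ∑ p, x (a, p) • κ p
    convert this using 1
    simp only [ι, Fintype.sum_prod_type, C, Matrix.of_apply, Matrix.map_apply, map_sum, map_smul,
      inner_sum, sum_inner, inner_smul_left, inner_smul_right]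
    refine Finset.sum_congr rfl fun a _ => ?_
    rw [Finset.sum_comm]
    refine Finset.sum_congr rfl fun b _ => ?_
    rw [Finset.sum_comm]
    refine Finset.sum_congr rfl fun q _ => ?_
    rw [Finset.mul_sum]
    refine Finset.sum_congr rfl fun p _ => ?_
    simp
    ring
  let V : ι → H →ₗ[ℂ] K := fun e => ∑ a, ∑ p, star (X e (a, p)) • ketBra (κ p) (h a)
  have hV : ∀ e a p, inner ℂ (κ p) (V e (h a)) = star (X e (a, p)) := by
    intro e a p
    simp [V, OrthonormalBasis.inner_eq_ite]
  have hEV : E = ∑ e, conj (V e) := by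
    have hdec : ∀ ρ : H →ₗ[ℂ] H, ρ = ∑ a, ∑ b, inner ℂ (h a) (ρ (h b)) • ketBra (h a) (h b) := by
      intro ρ
      refine h.toBasis.ext fun b => ?_
      simp only [OrthonormalBasis.coe_toBasis, LinearMap.sum_apply, LinearMap.smul_apply,
        ketBra_apply, OrthonormalBasis.inner_eq_ite, ite_smul, one_smul, zero_smul, smul_ite,
        smul_zero, Finset.sum_ite_eq', Finset.mem_univ, if_true]
      exact (h.sum_repr' _).symm
    have hunit : ∀ a b, E (ketBra (h a) (h b)) = (∑ e, conj (V e)) (ketBra (h a) (h b)) := by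
      intro a b
      refine κ.toBasis.ext fun q => ext_inner_left ℂ fun y => ?_
      rw [← κ.sum_repr' y]
      simp only [sum_inner, inner_smul_left]
      refine Finset.sum_congr rfl fun p _ => ?_
      congr 1
      have := congrFun (congrFun hX (a, p)) (b, q)
      simp only [C, Matrix.of_apply, Matrix.mul_apply, Matrix.conjTranspose_apply] at this
      rw [OrthonormalBasis.coe_toBasis, this]
      simp only [LinearMap.sum_apply, inner_sum, conj_apply, LinearMap.comp_apply, ketBra_apply,
        map_smul, inner_smul_right, LinearMap.adjoint_inner_right, hV]
      refine Finset.sum_congr rfl fun e _ => ?_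
      rw [← inner_conj_symm, hV]
      simp [mul_comm]
    ext ρ : 1
    rw [hdec ρ]
    simp only [map_sum, map_smul, hunit]
  let e := Fintype.equivFin ι
  refine ⟨Fintype.card ι, fun i => V (e.symm i), ?_⟩
  rw [hEV]
  exact (Equiv.sum_comp e.symm fun i => conj (V i)).symm

/-- The Kraus operators of a channel satisfy the completeness relation. -/
lemma IsChannel.sum_adjoint_comp {ι : Type*} [Fintype ι] {V : ι → H →ₗ[ℂ] K}
    (hE : IsChannel (∑ i, conj (V i))) :
    ∑ i, LinearMap.adjoint (V i) ∘ₗ V i = LinearMap.id := by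
  refine eq_of_trace_comp_eq fun ρ => ?_
  have := trace_sum_conj V LinearMap.id ρ
  simp only [LinearMap.id_comp] at this
  rw [← this, hE.trace_preserving, LinearMap.id_comp]

end Kraus

/-! ### Direct sums and tensor products of Hilbert spaces -/

section DirectSumMaps

variable {n : ℕ} {F : Fin n → Type*} [∀ i, NormedAddCommGroup (F i)]
  [∀ i, InnerProductSpace ℂ (F i)] [∀ i, FiniteDimensional ℂ (F i)]

/-- The inclusion of the `i`-th summand in a Hilbert space direct sum. -/
def incl (F : Fin n → Type*) [∀ i, NormedAddCommGroup (F i)] [∀ i, InnerProductSpace ℂ (F i)]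
    (i : Fin n) : F i →ₗ[ℂ] PiLp 2 F :=
  (WithLp.linearEquiv 2 ℂ (∀ i, F i)).symm.toLinearMap ∘ₗ LinearMap.single ℂ F i

/-- The projection of a Hilbert space direct sum on its `i`-th summand. -/
def proj (F : Fin n → Type*) [∀ i, NormedAddCommGroup (F i)] [∀ i, InnerProductSpace ℂ (F i)]
    (i : Fin n) : PiLp 2 F →ₗ[ℂ] F i := PiLp.projₗ 2 F i

@[simp] lemma proj_apply (i : Fin n) (x : PiLp 2 F) : proj F i x = x i := rfl

lemma incl_apply (i j : Fin n) (x : F i) : incl F i x j = Pi.single i x j := rfl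

@[simp] lemma incl_apply_same (i : Fin n) (x : F i) : incl F i x i = x := by simp [incl_apply]

@[simp] lemma incl_apply_ne {i j : Fin n} (h : i ≠ j) (x : F i) : incl F i x j = 0 := by
  simp [incl_apply, h.symm]

@[simp] lemma adjoint_proj (i : Fin n) : LinearMap.adjoint (proj F i) = incl F i := by
  symm
  rw [LinearMap.eq_adjoint_iff]
  intro x y
  rw [PiLp.inner_apply, Finset.sum_eq_single i] <;> simp +contextual [incl_apply]

@[simp] lemma adjoint_incl (i : Fin n) : LinearMap.adjoint (incl F i) = proj F i := by
  rw [← adjoint_proj, LinearMap.adjoint_adjoint]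

@[simp] lemma proj_comp_incl (i : Fin n) : proj F i ∘ₗ incl F i = LinearMap.id := by ext; simp

lemma proj_comp_incl_ne {i j : Fin n} (h : i ≠ j) : proj F i ∘ₗ incl F j = 0 := by
  ext; simp [h.symm]

lemma sum_incl_comp_proj : ∑ i, incl F i ∘ₗ proj F i = LinearMap.id := by
  ext x i
  simp [incl_apply]

lemma sum_incl_apply (x : PiLp 2 F) : ∑ i, incl F i (x i) = x := by
  simpa using LinearMap.congr_fun (sum_incl_comp_proj (F := F)) x

/-- The block diagonal operator `⨁ᵢ bᵢ`. -/
def blockDiag (b : ∀ i, F i →ₗ[ℂ] F i) : PiLp 2 F →ₗ[ℂ] PiLp 2 F :=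
  ∑ i, incl F i ∘ₗ b i ∘ₗ proj F i

lemma proj_comp_blockDiag (b : ∀ i, F i →ₗ[ℂ] F i) (i : Fin n) :
    proj F i ∘ₗ blockDiag b = b i ∘ₗ proj F i := by
  rw [blockDiag, comp_sum, Finset.sum_eq_single i]
  · rw [← LinearMap.comp_assoc, proj_comp_incl, LinearMap.id_comp]
  · intro j _ hj
    rw [← LinearMap.comp_assoc, proj_comp_incl_ne hj.symm, LinearMap.zero_comp]
  · simp

lemma blockDiag_comp_incl (b : ∀ i, F i →ₗ[ℂ] F i) (i : Fin n) :
    blockDiag b ∘ₗ incl F i = incl F i ∘ₗ b i := by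
  rw [blockDiag, sum_comp, Finset.sum_eq_single i]
  · rw [LinearMap.comp_assoc, LinearMap.comp_assoc, proj_comp_incl, LinearMap.comp_id]
  · intro j _ hj
    rw [LinearMap.comp_assoc, LinearMap.comp_assoc, proj_comp_incl_ne hj, LinearMap.comp_zero,
      LinearMap.comp_zero]
  · simp

end DirectSumMaps

section TensorMaps

variable {H : Type*} [NormedAddCommGroup H] [InnerProductSpace ℂ H] [FiniteDimensional ℂ H]
  {K : Type*} [NormedAddCommGroup K] [InnerProductSpace ℂ K] [FiniteDimensional ℂ K]
  {S : Type*} [NormedAddCommGroup S] [InnerProductSpace ℂ S] [FiniteDimensional ℂ S]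
  {T : Type*} [NormedAddCommGroup T] [InnerProductSpace ℂ T] [FiniteDimensional ℂ T]

/-- The map `1 ⊗ |s⟩ : H → H ⊗ S`. -/
def insertRight (H : Type*) [NormedAddCommGroup H] [InnerProductSpace ℂ H] (s : S) :
    H →ₗ[ℂ] H ⊗[ℂ] S := (TensorProduct.mk ℂ H S).flip s

/-- The map `1 ⊗ ⟨s| : H ⊗ S → H`. -/
def contractRight (H : Type*) [NormedAddCommGroup H] [InnerProductSpace ℂ H] (s : S) :
    H ⊗[ℂ] S →ₗ[ℂ] H :=
  (TensorProduct.rid ℂ H).toLinearMap ∘ₗ LinearMap.lTensor H (innerₛₗ ℂ s)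

/-- The map `|h⟩ ⊗ 1 : S → H ⊗ S`. -/
def insertLeft (S : Type*) [NormedAddCommGroup S] [InnerProductSpace ℂ S] (h : H) :
    S →ₗ[ℂ] H ⊗[ℂ] S := TensorProduct.mk ℂ H S h

/-- The map `⟨h| ⊗ 1 : H ⊗ S → S`. -/
def contractLeft (S : Type*) [NormedAddCommGroup S] [InnerProductSpace ℂ S] (h : H) :
    H ⊗[ℂ] S →ₗ[ℂ] S :=
  (TensorProduct.lid ℂ S).toLinearMap ∘ₗ LinearMap.rTensor S (innerₛₗ ℂ h)

@[simp] lemma insertRight_apply (s : S) (x : H) : insertRight H s x = x ⊗ₜ s := rfl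

@[simp] lemma insertLeft_apply (h : H) (x : S) : insertLeft S h x = h ⊗ₜ x := rfl

@[simp] lemma contractRight_tmul (s t : S) (x : H) :
    contractRight H s (x ⊗ₜ t) = inner ℂ s t • x := by simp [contractRight]

@[simp] lemma contractLeft_tmul (h x : H) (s : S) :
    contractLeft S h (x ⊗ₜ s) = inner ℂ h x • s := by simp [contractLeft]

lemma adjoint_insertRight (s : S) : LinearMap.adjoint (insertRight H s) = contractRight H s := by
  refine LinearMap.ext fun z => ext_inner_left ℂ fun x => ?_
  rw [LinearMap.adjoint_inner_right]
  induction z with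
  | zero => simp
  | add z w hz hw => rw [map_add, inner_add_right, inner_add_right, hz, hw]
  | tmul a b => simp [inner_smul_right, mul_comm]

lemma adjoint_contractRight (s : S) :
    LinearMap.adjoint (contractRight H s) = insertRight H s := by
  rw [← adjoint_insertRight, LinearMap.adjoint_adjoint]

lemma adjoint_insertLeft (h : H) : LinearMap.adjoint (insertLeft S h) = contractLeft S h := by
  refine LinearMap.ext fun z => ext_inner_left ℂ fun x => ?_
  rw [LinearMap.adjoint_inner_right]
  induction z with
  | zero => simp
  | add z w hz hw => rw [map_add, inner_add_right, inner_add_right, hz, hw]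
  | tmul a b => simp [inner_smul_right]

lemma adjoint_contractLeft (h : H) :
    LinearMap.adjoint (contractLeft S h) = insertLeft S h := by
  rw [← adjoint_insertLeft, LinearMap.adjoint_adjoint]

lemma insertRight_comp_contractRight (s t : S) :
    insertRight H s ∘ₗ contractRight H t = LinearMap.lTensor H (ketBra s t) := by
  refine TensorProduct.ext' fun x y => ?_
  simp [TensorProduct.smul_tmul']

lemma insertLeft_comp_contractLeft (h k : H) :
    insertLeft S h ∘ₗ contractLeft S k = LinearMap.rTensor S (ketBra h k) := by
  refine TensorProduct.ext' fun x y => ?_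
  simp [TensorProduct.smul_tmul']

lemma rTensor_sum {ι : Type*} (s : Finset ι) (f : ι → H →ₗ[ℂ] K) :
    LinearMap.rTensor S (∑ i ∈ s, f i) = ∑ i ∈ s, LinearMap.rTensor S (f i) :=
  map_sum (LinearMap.rTensorHom S) f s

lemma lTensor_sum {ι : Type*} (s : Finset ι) (f : ι → H →ₗ[ℂ] K) :
    LinearMap.lTensor S (∑ i ∈ s, f i) = ∑ i ∈ s, LinearMap.lTensor S (f i) :=
  map_sum (LinearMap.lTensorHom S) f s

/-- The partial contractions with the vectors of the left factor separate points. -/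
lemma eq_of_contractLeft_eq {x y : H ⊗[ℂ] S}
    (h : ∀ k, contractLeft S k x = contractLeft S k y) : x = y := by
  have hid : LinearMap.rTensor S (LinearMap.id : H →ₗ[ℂ] H) = LinearMap.id :=
    LinearMap.rTensor_id _ _
  rw [← LinearMap.id_apply (R := ℂ) x, ← LinearMap.id_apply (R := ℂ) y, ← hid,
    ← sum_ketBra_self (stdOrthonormalBasis ℂ H), rTensor_sum]
  simp only [← insertLeft_comp_contractLeft, LinearMap.sum_apply, LinearMap.comp_apply, h]

lemma actLeft_conj (V : H →ₗ[ℂ] K) : actLeft S (conj V) = conj (LinearMap.rTensor S V) := by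
  refine LinearMap.ext fun X => ?_
  obtain ⟨z, rfl⟩ := (homTensorHomEquiv ℂ H S H S).surjective X
  induction z with
  | zero => simp
  | add z w hz hw => rw [map_add, map_add, map_add, hz, hw]
  | tmul a b =>
    refine TensorProduct.ext' fun x y => ?_
    simp only [actLeft, LinearMap.comp_apply, LinearEquiv.coe_coe, LinearEquiv.symm_apply_apply]
    simp [conj_apply]

lemma actRight_conj (V : H →ₗ[ℂ] K) : actRight S (conj V) = conj (LinearMap.lTensor S V) := by
  refine LinearMap.ext fun X => ?_
  obtain ⟨z, rfl⟩ := (homTensorHomEquiv ℂ S H S H).surjective X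
  induction z with
  | zero => simp
  | add z w hz hw => rw [map_add, map_add, map_add, hz, hw]
  | tmul a b =>
    refine TensorProduct.ext' fun x y => ?_
    simp only [actRight, LinearMap.comp_apply, LinearEquiv.coe_coe, LinearEquiv.symm_apply_apply]
    simp [conj_apply]

lemma actRight_sum {ι : Type*} (s : Finset ι)
    (E : ι → (H →ₗ[ℂ] H) →ₗ[ℂ] (K →ₗ[ℂ] K)) :
    actRight S (∑ i ∈ s, E i) = ∑ i ∈ s, actRight S (E i) := by
  have h := map_sum (LinearMap.lTensorHom (S →ₗ[ℂ] S)) E s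
  simp only [LinearMap.coe_lTensorHom] at h
  refine LinearMap.ext fun X => ?_
  simp only [actRight, h, LinearMap.comp_apply, LinearMap.sum_apply, map_sum]

/-- Kraus form of the partial trace. -/
lemma traceRight_eq_sum_conj {ι : Type*} [Fintype ι] (b : OrthonormalBasis ι ℂ S) :
    (traceRight : ((H ⊗[ℂ] S) →ₗ[ℂ] (H ⊗[ℂ] S)) →ₗ[ℂ] (H →ₗ[ℂ] H)) =
      ∑ k, conj (contractRight H (b k)) := by
  refine LinearMap.ext fun X => ?_
  obtain ⟨z, rfl⟩ := (homTensorHomEquiv ℂ H S H S).surjective X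
  induction z with
  | zero => simp
  | add z w hz hw => rw [map_add, map_add, map_add, hz, hw]
  | tmul f g =>
    ext x
    simp only [traceRight, LinearMap.comp_apply, LinearEquiv.coe_coe, LinearEquiv.symm_apply_apply]
    simp [conj_apply, adjoint_contractRight, LinearMap.trace_eq_sum_inner g b, Finset.sum_smul]

lemma trace_comp_traceRight (f : H →ₗ[ℂ] H) (X : (H ⊗[ℂ] S) →ₗ[ℂ] (H ⊗[ℂ] S)) :
    LinearMap.trace ℂ H (f ∘ₗ traceRight X) =
      LinearMap.trace ℂ (H ⊗[ℂ] S) (LinearMap.rTensor S f ∘ₗ X) := by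
  have h : ∀ s : S, insertRight H s ∘ₗ f ∘ₗ contractRight H s =
      LinearMap.rTensor S f ∘ₗ LinearMap.lTensor H (ketBra s s) := fun s =>
    TensorProduct.ext' fun x y => by simp [TensorProduct.smul_tmul']
  rw [traceRight_eq_sum_conj (stdOrthonormalBasis ℂ S), trace_sum_conj]
  simp only [adjoint_contractRight, h, ← comp_sum]
  rw [← lTensor_sum, sum_ketBra_self, LinearMap.lTensor_id, LinearMap.comp_id]

end TensorMaps

/-! ### Representation unitaries -/

section Blocks

variable {H : Type*} [NormedAddCommGroup H] [InnerProductSpace ℂ H] [FiniteDimensional ℂ H]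
  {n : ℕ} {L R : Fin n → Type}
  [∀ i, NormedAddCommGroup (L i)] [∀ i, InnerProductSpace ℂ (L i)]
  [∀ i, FiniteDimensional ℂ (L i)]
  [∀ i, NormedAddCommGroup (R i)] [∀ i, InnerProductSpace ℂ (R i)]
  [∀ i, FiniteDimensional ℂ (R i)]
  (U : H ≃ₗᵢ[ℂ] PiLp 2 (fun i => L i ⊗[ℂ] R i))

/-- The component `H → Lᵢ ⊗ Rᵢ` of a unitary `U : H → ⨁ᵢ Lᵢ ⊗ Rᵢ`. -/
def component (i : Fin n) : H →ₗ[ℂ] L i ⊗[ℂ] R i :=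
  proj (fun i => L i ⊗[ℂ] R i) i ∘ₗ U.toLinearEquiv.toLinearMap

lemma component_apply (i : Fin n) (x : H) : component U i x = U x i := rfl

lemma adjoint_component (i : Fin n) : LinearMap.adjoint (component U i) =
    U.symm.toLinearEquiv.toLinearMap ∘ₗ incl (fun i => L i ⊗[ℂ] R i) i := by
  symm
  rw [LinearMap.eq_adjoint_iff]
  intro x y
  rw [component, LinearMap.comp_apply, LinearMap.comp_apply, ← LinearMap.adjoint_inner_left,
    adjoint_proj]
  exact (LinearIsometryEquiv.inner_map_eq_flip U.symm _ _)

@[simp] lemma component_comp_adjoint (i : Fin n) :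
    component U i ∘ₗ LinearMap.adjoint (component U i) = LinearMap.id := by
  rw [adjoint_component]
  refine LinearMap.ext fun x => ?_
  simp [component]

lemma component_comp_adjoint_ne {i j : Fin n} (h : i ≠ j) :
    component U i ∘ₗ LinearMap.adjoint (component U j) = 0 := by
  rw [adjoint_component]
  refine LinearMap.ext fun x => ?_
  simp [component, h.symm]

lemma sum_adjoint_comp_component :
    ∑ i, LinearMap.adjoint (component U i) ∘ₗ component U i = LinearMap.id := by
  simp only [adjoint_component]
  refine LinearMap.ext fun x => ?_
  simp only [LinearMap.sum_apply, LinearMap.comp_apply, component_apply, ← map_sum,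
    sum_incl_apply]
  exact U.symm_apply_apply x

/-- The operator `U† (⨁ᵢ bᵢ ⊗ 1) U` on `H`. -/
def blockOp (b : ∀ i, L i →ₗ[ℂ] L i) : H →ₗ[ℂ] H :=
  ∑ i, LinearMap.adjoint (component U i) ∘ₗ LinearMap.rTensor (R i) (b i) ∘ₗ component U i

lemma component_comp_blockOp (b : ∀ i, L i →ₗ[ℂ] L i) (i : Fin n) :
    component U i ∘ₗ blockOp U b = LinearMap.rTensor (R i) (b i) ∘ₗ component U i := by
  rw [blockOp, comp_sum, Finset.sum_eq_single i]
  · rw [← LinearMap.comp_assoc, component_comp_adjoint, LinearMap.id_comp]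
  · intro j _ hj
    rw [← LinearMap.comp_assoc, component_comp_adjoint_ne U hj.symm, LinearMap.zero_comp]
  · simp

lemma eq_of_component_comp_eq {K : Type*} [AddCommGroup K] [Module ℂ K] {X Y : K →ₗ[ℂ] H}
    (h : ∀ i, component U i ∘ₗ X = component U i ∘ₗ Y) : X = Y :=
  LinearMap.ext fun x => U.injective (PiLp.ext fun i => LinearMap.congr_fun (h i) x)

lemma blockOp_one : blockOp U (fun _ => LinearMap.id) = LinearMap.id := by
  simp [blockOp, sum_adjoint_comp_component]

lemma IsRepresentationUnitary.mem_iff {A : StarSubalgebra ℂ (H →ₗ[ℂ] H)}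
    {U : H ≃ₗᵢ[ℂ] PiLp 2 (fun i => L i ⊗[ℂ] R i)} (hU : IsRepresentationUnitary A U)
    {a : H →ₗ[ℂ] H} : a ∈ A ↔ ∃ b : ∀ i, L i →ₗ[ℂ] L i, a = blockOp U b := by
  rw [hU a]
  refine exists_congr fun b => ⟨fun h => eq_of_component_comp_eq U fun i => ?_, ?_⟩
  · rw [component_comp_blockOp]
    exact LinearMap.ext fun x => h x i
  · rintro rfl x i
    exact LinearMap.congr_fun (component_comp_blockOp U b i) x

lemma traceCommutant_apply (ρ : H →ₗ[ℂ] H) (i : Fin n) :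
    traceCommutant U ρ i = traceRight (conj (component U i) ρ) := by
  have : block U i ρ = conj (component U i) ρ := by
    rw [conj_apply, adjoint_component]
    rfl
  simp only [traceCommutant, LinearMap.pi_apply, LinearMap.comp_apply, this]

/-- The map `ρ ↦ Tr_{A'}(ρ)` is dual, for the trace pairing, to the inclusion of `⨁ᵢ 𝓛(Lᵢ)`
in `𝓛(H)`. -/
lemma trace_comp_traceCommutant (b : ∀ i, L i →ₗ[ℂ] L i) (ρ : H →ₗ[ℂ] H) :
    ∑ i, LinearMap.trace ℂ (L i) (b i ∘ₗ traceCommutant U ρ i) =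
      LinearMap.trace ℂ H (blockOp U b ∘ₗ ρ) := by
  simp only [traceCommutant_apply, trace_comp_traceRight, trace_conj, blockOp, sum_comp, map_sum]

end Blocks

/-! ### The lean splitting map of a representation unitary -/

section GeneralSplitting

variable {H : Type*} [NormedAddCommGroup H] [InnerProductSpace ℂ H] [FiniteDimensional ℂ H]
  {L : Type*} [NormedAddCommGroup L] [InnerProductSpace ℂ L] [FiniteDimensional ℂ L]
  {R : Type*} [NormedAddCommGroup R] [InnerProductSpace ℂ R] [FiniteDimensional ℂ R]

lemma dagger_comp (χ : H →ₗᵢ[ℂ] L ⊗[ℂ] R) : dagger χ ∘ₗ χ.toLinearMap = LinearMap.id :=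
  adjoint_comp_isometry χ

lemma stlocR_subset_centralizer (χ : H →ₗᵢ[ℂ] L ⊗[ℂ] R) :
    stlocR χ ⊆ Set.centralizer (stlocL χ) := by
  rintro a ⟨d, -, ha⟩ a' ⟨c, -, ha'⟩
  have h1 : χ.toLinearMap ∘ₗ (a' ∘ₗ a) = χ.toLinearMap ∘ₗ (a ∘ₗ a') := by
    rw [← LinearMap.comp_assoc, ← LinearMap.comp_assoc, ha, ha', LinearMap.comp_assoc,
      LinearMap.comp_assoc, ha, ha', ← LinearMap.comp_assoc, ← LinearMap.comp_assoc,
      LinearMap.rTensor_comp_lTensor, LinearMap.lTensor_comp_rTensor]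
  exact LinearMap.ext fun x => χ.injective (LinearMap.congr_fun h1 x)

/-- An operator on `L ⊗ R` that commutes with `𝓛(L) ⊗ 1` belongs to `1 ⊗ 𝓛(R)`. -/
lemma exists_eq_lTensor_of_commute [Nontrivial L] (f : L ⊗[ℂ] R →ₗ[ℂ] L ⊗[ℂ] R)
    (hf : ∀ b : L →ₗ[ℂ] L, f ∘ₗ LinearMap.rTensor R b = LinearMap.rTensor R b ∘ₗ f) :
    ∃ d : R →ₗ[ℂ] R, f = LinearMap.lTensor L d := by
  obtain ⟨l, hl⟩ := exists_norm_eq L zero_le_one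
  refine ⟨contractLeft R l ∘ₗ f ∘ₗ insertLeft R l, TensorProduct.ext' fun x r => ?_⟩
  have h := LinearMap.congr_fun (hf (ketBra x l)) (l ⊗ₜ r)
  rw [← insertLeft_comp_contractLeft] at h
  simpa [inner_self_eq_norm_sq_to_K, hl] using h

end GeneralSplitting

section Canonical

variable {H : Type*} [NormedAddCommGroup H] [InnerProductSpace ℂ H] [FiniteDimensional ℂ H]
  {n : ℕ} {L R : Fin n → Type}
  [∀ i, NormedAddCommGroup (L i)] [∀ i, InnerProductSpace ℂ (L i)]
  [∀ i, FiniteDimensional ℂ (L i)]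
  [∀ i, NormedAddCommGroup (R i)] [∀ i, InnerProductSpace ℂ (R i)]
  [∀ i, FiniteDimensional ℂ (R i)]
  (U : H ≃ₗᵢ[ℂ] PiLp 2 (fun i => L i ⊗[ℂ] R i))

/-- The map `H → (⨁ᵢ Lᵢ) ⊗ (⨁ᵢ Rᵢ)` that sends the `i`-th block `Lᵢ ⊗ Rᵢ` to the tensor product
of the `i`-th summands. -/
def splittingOp : H →ₗ[ℂ] PiLp 2 L ⊗[ℂ] PiLp 2 R :=
  ∑ i, TensorProduct.map (incl L i) (incl R i) ∘ₗ component U i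

lemma adjoint_splittingOp : LinearMap.adjoint (splittingOp U) =
    ∑ i, LinearMap.adjoint (component U i) ∘ₗ TensorProduct.map (proj L i) (proj R i) := by
  simp [splittingOp, LinearMap.adjoint_comp]

lemma map_proj_comp_map_incl (i : Fin n) :
    TensorProduct.map (proj L i) (proj R i) ∘ₗ TensorProduct.map (incl L i) (incl R i) =
      LinearMap.id := by
  rw [← TensorProduct.map_comp, proj_comp_incl, proj_comp_incl, TensorProduct.map_id]

lemma map_proj_comp_map_incl_ne {i j : Fin n} (h : i ≠ j) :
    TensorProduct.map (proj L i) (proj R i) ∘ₗ TensorProduct.map (incl L j) (incl R j) = 0 := by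
  rw [← TensorProduct.map_comp, proj_comp_incl_ne h, TensorProduct.map_zero_left]

lemma map_proj_comp_splittingOp (i : Fin n) :
    TensorProduct.map (proj L i) (proj R i) ∘ₗ splittingOp U = component U i := by
  rw [splittingOp, comp_sum, Finset.sum_eq_single i]
  · rw [← LinearMap.comp_assoc, map_proj_comp_map_incl, LinearMap.id_comp]
  · intro j _ hj
    rw [← LinearMap.comp_assoc, map_proj_comp_map_incl_ne hj.symm, LinearMap.zero_comp]
  · simp

lemma adjoint_comp_splittingOp :
    LinearMap.adjoint (splittingOp U) ∘ₗ splittingOp U = LinearMap.id := by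
  rw [adjoint_splittingOp, sum_comp, ← sum_adjoint_comp_component U]
  simp only [LinearMap.comp_assoc, map_proj_comp_splittingOp]

/-- The splitting map `H → (⨁ᵢ Lᵢ) ⊗ (⨁ᵢ Rᵢ)` of a unitary `U : H → ⨁ᵢ Lᵢ ⊗ Rᵢ`. -/
def splitting : H →ₗᵢ[ℂ] PiLp 2 L ⊗[ℂ] PiLp 2 R :=
  isometryOfAdjoint (splittingOp U) (adjoint_comp_splittingOp U)

lemma toLinearMap_splitting : (splitting U).toLinearMap = splittingOp U := rfl

lemma dagger_splitting : dagger (splitting U) =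
    ∑ i, LinearMap.adjoint (component U i) ∘ₗ TensorProduct.map (proj L i) (proj R i) :=
  adjoint_splittingOp U

lemma splittingOp_comp_adjoint_component (i : Fin n) :
    splittingOp U ∘ₗ LinearMap.adjoint (component U i) =
      TensorProduct.map (incl L i) (incl R i) := by
  rw [splittingOp, sum_comp, Finset.sum_eq_single i]
  · rw [LinearMap.comp_assoc, component_comp_adjoint, LinearMap.comp_id]
  · intro j _ hj
    rw [LinearMap.comp_assoc, component_comp_adjoint_ne U hj, LinearMap.comp_zero]
  · simp

lemma imageProj_splitting : imageProj (splitting U) =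
    ∑ i, TensorProduct.map (incl L i ∘ₗ proj L i) (incl R i ∘ₗ proj R i) := by
  rw [imageProj, dagger_splitting, toLinearMap_splitting, comp_sum]
  refine Finset.sum_congr rfl fun i _ => ?_
  rw [← LinearMap.comp_assoc, splittingOp_comp_adjoint_component, ← TensorProduct.map_comp]

/-- An operator `F` on `(⨁ᵢ Lᵢ) ⊗ (⨁ᵢ Rᵢ)` that restricts to `fᵢ` on the block `Lᵢ ⊗ Rᵢ`
represents the operator `⨁ᵢ fᵢ` of `H`. -/
lemma represents_of_blocks {a : H →ₗ[ℂ] H} {f : ∀ i, L i ⊗[ℂ] R i →ₗ[ℂ] L i ⊗[ℂ] R i}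
    {F : PiLp 2 L ⊗[ℂ] PiLp 2 R →ₗ[ℂ] PiLp 2 L ⊗[ℂ] PiLp 2 R}
    (ha : ∀ i, component U i ∘ₗ a = f i ∘ₗ component U i)
    (hproj : ∀ i, TensorProduct.map (proj L i) (proj R i) ∘ₗ F =
      f i ∘ₗ TensorProduct.map (proj L i) (proj R i))
    (hincl : ∀ i, F ∘ₗ TensorProduct.map (incl L i) (incl R i) =
      TensorProduct.map (incl L i) (incl R i) ∘ₗ f i) :
    a ∘ₗ dagger (splitting U) = dagger (splitting U) ∘ₗ F ∧
      (splitting U).toLinearMap ∘ₗ a = F ∘ₗ (splitting U).toLinearMap := by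
  have h : splittingOp U ∘ₗ a = F ∘ₗ splittingOp U := by
    simp only [splittingOp, sum_comp, comp_sum, LinearMap.comp_assoc, ha]
    simp only [← LinearMap.comp_assoc, hincl]
  refine ⟨?_, h⟩
  have hadj : ∀ i, a ∘ₗ LinearMap.adjoint (component U i) =
      LinearMap.adjoint (component U i) ∘ₗ f i := by
    refine fun i => eq_of_component_comp_eq U fun j => ?_
    rw [← LinearMap.comp_assoc, ha, LinearMap.comp_assoc]
    by_cases hij : j = i
    · subst hij
      rw [component_comp_adjoint, LinearMap.comp_id, ← LinearMap.comp_assoc,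
        component_comp_adjoint, LinearMap.id_comp]
    · rw [component_comp_adjoint_ne U hij, LinearMap.comp_zero, ← LinearMap.comp_assoc,
        component_comp_adjoint_ne U hij, LinearMap.zero_comp]
  rw [dagger_splitting, comp_sum, sum_comp]
  refine Finset.sum_congr rfl fun i _ => ?_
  rw [← LinearMap.comp_assoc, hadj, LinearMap.comp_assoc, LinearMap.comp_assoc, hproj]

lemma stlocL_splitting : stlocL (splitting U) = Set.range (blockOp U) := by
  refine Set.Subset.antisymm ?_ ?_
  · rintro a ⟨B, -, hB⟩
    refine ⟨fun i => proj L i ∘ₗ B ∘ₗ incl L i, eq_of_component_comp_eq U fun i => ?_⟩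
    rw [component_comp_blockOp, ← map_proj_comp_splittingOp U i, LinearMap.comp_assoc a]
    rw [toLinearMap_splitting] at hB
    rw [hB, splittingOp]
    simp only [comp_sum]
    refine Finset.sum_congr rfl fun j _ => ?_
    simp only [← LinearMap.comp_assoc]
    congr 1
    refine TensorProduct.ext' fun x y => ?_
    by_cases hij : j = i
    · subst hij
      simp
    · simp [hij]
  · rintro _ ⟨b, rfl⟩
    refine ⟨blockDiag b, represents_of_blocks U (component_comp_blockOp U b) ?_ ?_⟩
    · intro i
      rw [LinearMap.map_comp_rTensor, proj_comp_blockDiag, LinearMap.rTensor_comp_map]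
    · intro i
      rw [LinearMap.rTensor_comp_map, blockDiag_comp_incl, LinearMap.map_comp_rTensor]

lemma represents_splitting {A : StarSubalgebra ℂ (H →ₗ[ℂ] H)}
    {U : H ≃ₗᵢ[ℂ] PiLp 2 (fun i => L i ⊗[ℂ] R i)} (hU : IsRepresentationUnitary A U) :
    Represents (splitting U) A := by
  rw [Represents, stlocL_splitting]
  ext a
  rw [SetLike.mem_coe, hU.mem_iff, Set.mem_range]
  exact exists_congr fun b => eq_comm

lemma isBalanced_splitting [∀ i, Nontrivial (L i)] : IsBalanced (splitting U) := by
  refine Set.Subset.antisymm (stlocR_subset_centralizer _) fun a ha => ?_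
  rw [stlocL_splitting] at ha
  have hsingle : ∀ (i : Fin n) (b : L i →ₗ[ℂ] L i),
      (LinearMap.adjoint (component U i) ∘ₗ LinearMap.rTensor (R i) b ∘ₗ component U i) ∘ₗ a =
      a ∘ₗ LinearMap.adjoint (component U i) ∘ₗ LinearMap.rTensor (R i) b ∘ₗ component U i := by
    intro i b
    have hb : blockOp U (Pi.single i b) =
        LinearMap.adjoint (component U i) ∘ₗ LinearMap.rTensor (R i) b ∘ₗ component U i := by
      rw [blockOp, Finset.sum_eq_single i]
      · simp
      · intro j _ hj
        simp [Pi.single_eq_of_ne hj]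
      · simp
    rw [← hb]
    exact ha _ ⟨_, rfl⟩
  -- The diagonal blocks of `a` commute with `𝓛(Lᵢ) ⊗ 1`.
  have hcomm : ∀ i, ∃ d : R i →ₗ[ℂ] R i,
      component U i ∘ₗ a ∘ₗ LinearMap.adjoint (component U i) = LinearMap.lTensor (L i) d := by
    refine fun i => exists_eq_lTensor_of_commute _ fun b => ?_
    have h := congrArg (fun f => component U i ∘ₗ f ∘ₗ LinearMap.adjoint (component U i))
      (hsingle i b)
    simp only [LinearMap.comp_assoc, component_comp_adjoint, LinearMap.comp_id] at h
    simp only [← LinearMap.comp_assoc, component_comp_adjoint, LinearMap.id_comp] at h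
    simp only [← LinearMap.comp_assoc, h]
  choose d hd using hcomm
  -- Commutation with the projector on the `i`-th block makes `a` block diagonal.
  have hdiag : ∀ i, component U i ∘ₗ a = LinearMap.lTensor (L i) (d i) ∘ₗ component U i := by
    intro i
    have h := congrArg (fun f => component U i ∘ₗ f) (hsingle i LinearMap.id)
    simp only [LinearMap.rTensor_id, LinearMap.id_comp] at h
    rw [← LinearMap.comp_assoc, ← LinearMap.comp_assoc, component_comp_adjoint,
      LinearMap.id_comp] at h
    rw [h, ← hd, LinearMap.comp_assoc, LinearMap.comp_assoc]
  refine ⟨blockDiag d, represents_of_blocks U hdiag ?_ ?_⟩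
  · intro i
    rw [LinearMap.map_comp_lTensor, proj_comp_blockDiag, LinearMap.lTensor_comp_map]
  · intro i
    rw [LinearMap.lTensor_comp_map, blockDiag_comp_incl, LinearMap.map_comp_lTensor]

lemma incl_comp_proj_comp_ne {i j : Fin n} (h : i ≠ j) :
    (incl L i ∘ₗ proj L i) ∘ₗ incl L j ∘ₗ proj L j = 0 := by
  ext x : 1; simp [h.symm]

/-- The projectors on the summands `Lᵢ` are left-consistent, and the projector on the image of the
splitting map is built from them; so an operator that commutes with all left-consistent operators
is left-consistent. -/
lemma centralizer_consL_splitting :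
    Set.centralizer (consL (splitting U)) ⊆ consL (splitting U) := by
  intro X hX
  have hP : ∀ i, incl L i ∘ₗ proj L i ∈ consL (splitting U) := by
    intro i
    change _ ∘ₗ _ = _ ∘ₗ _
    simp only [imageProj_splitting, sum_comp, comp_sum]
    refine Finset.sum_congr rfl fun j _ => ?_
    rw [LinearMap.map_comp_rTensor, LinearMap.rTensor_comp_map]
    by_cases hij : i = j
    · rw [hij]
    · rw [incl_comp_proj_comp_ne hij, incl_comp_proj_comp_ne (Ne.symm hij)]
  change _ ∘ₗ _ = _ ∘ₗ _
  simp only [imageProj_splitting, sum_comp, comp_sum]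
  refine Finset.sum_congr rfl fun j _ => ?_
  rw [LinearMap.map_comp_rTensor, LinearMap.rTensor_comp_map]
  congr 1
  exact hX _ (hP j)

lemma centralizer_consR_splitting :
    Set.centralizer (consR (splitting U)) ⊆ consR (splitting U) := by
  intro X hX
  have hP : ∀ i, incl R i ∘ₗ proj R i ∈ consR (splitting U) := by
    intro i
    change _ ∘ₗ _ = _ ∘ₗ _
    simp only [imageProj_splitting, sum_comp, comp_sum]
    refine Finset.sum_congr rfl fun j _ => ?_
    rw [LinearMap.map_comp_lTensor, LinearMap.lTensor_comp_map]
    by_cases hij : i = j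
    · rw [hij]
    · rw [incl_comp_proj_comp_ne hij, incl_comp_proj_comp_ne (Ne.symm hij)]
  change _ ∘ₗ _ = _ ∘ₗ _
  simp only [imageProj_splitting, sum_comp, comp_sum]
  refine Finset.sum_congr rfl fun j _ => ?_
  rw [LinearMap.map_comp_lTensor, LinearMap.lTensor_comp_map]
  congr 1
  exact hX _ (hP j)

lemma isLeanSplitting_splitting [∀ i, Nontrivial (L i)] : IsLeanSplitting (splitting U) where
  balanced := isBalanced_splitting U
  left := (Set.inter_eq_right.2 (centralizer_consL_splitting U)).symm
  right := (Set.inter_eq_right.2 (centralizer_consR_splitting U)).symm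

end Canonical

/-! ### Semi-causal channels are semi-localisable -/

section Sequential

variable {L R L' R' M : Type}
  [NormedAddCommGroup L] [InnerProductSpace ℂ L] [FiniteDimensional ℂ L]
  [NormedAddCommGroup R] [InnerProductSpace ℂ R] [FiniteDimensional ℂ R]
  [NormedAddCommGroup L'] [InnerProductSpace ℂ L'] [FiniteDimensional ℂ L']
  [NormedAddCommGroup R'] [InnerProductSpace ℂ R'] [FiniteDimensional ℂ R']
  [NormedAddCommGroup M] [InnerProductSpace ℂ M] [FiniteDimensional ℂ M]

lemma assoc_conj_apply (X : ((L' ⊗[ℂ] M) ⊗[ℂ] R) →ₗ[ℂ] ((L' ⊗[ℂ] M) ⊗[ℂ] R)) :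
    (TensorProduct.assoc ℂ L' M R).conj X = conj (H := (L' ⊗[ℂ] M) ⊗[ℂ] R)
      (K := L' ⊗[ℂ] (M ⊗[ℂ] R)) (TensorProduct.assoc ℂ L' M R).toLinearMap X := by
  have h : LinearMap.adjoint (𝕜 := ℂ) (E := (L' ⊗[ℂ] M) ⊗[ℂ] R) (F := L' ⊗[ℂ] (M ⊗[ℂ] R))
      (TensorProduct.assoc ℂ L' M R).toLinearMap =
      (TensorProduct.assoc ℂ L' M R).symm.toLinearMap := by
    exact ((LinearMap.eq_adjoint_iff (E := L' ⊗[ℂ] (M ⊗[ℂ] R)) (F := (L' ⊗[ℂ] M) ⊗[ℂ] R) _ _).2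
      fun x y => (TensorProduct.assocIsometry ℂ L' M R).symm.inner_map_eq_flip x y).symm
  rw [conj_apply, h]
  rfl

lemma sequential_conj {ι : Type*} [Fintype ι] (W : L →ₗ[ℂ] L' ⊗[ℂ] M)
    (V : ι → M ⊗[ℂ] R →ₗ[ℂ] R') : sequential (conj W) (∑ k, conj (V k)) =
      ∑ k, conj (LinearMap.lTensor L' (V k) ∘ₗ
        (TensorProduct.assoc ℂ L' M R).toLinearMap ∘ₗ LinearMap.rTensor R W) := by
  refine LinearMap.ext fun X => ?_
  rw [sequential, actLeft_conj, actRight_sum]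
  simp only [actRight_conj, LinearMap.comp_apply, LinearMap.sum_apply, LinearEquiv.coe_coe,
    assoc_conj_apply]
  exact Finset.sum_congr rfl fun k _ =>
    (congrArg (conj _) (conj_conj _ _ _)).trans (conj_conj _ _ _)

lemma contractLeft_lTensor (f : M →ₗ[ℂ] R') (k : L') (z : L' ⊗[ℂ] M) :
    contractLeft R' k (LinearMap.lTensor L' f z) = f (contractLeft M k z) := by
  have : contractLeft R' k ∘ₗ LinearMap.lTensor L' f = f ∘ₗ contractLeft M k :=
    TensorProduct.ext' fun x y => by simp
  exact LinearMap.congr_fun this z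

lemma contractLeft_assoc (k : L') (z : L' ⊗[ℂ] M) (r : R) :
    contractLeft (M ⊗[ℂ] R) k (TensorProduct.assoc ℂ L' M R (z ⊗ₜ r)) =
      contractLeft M k z ⊗ₜ r := by
  induction z with
  | zero => simp
  | add z w hz hw => rw [TensorProduct.add_tmul, map_add, map_add, map_add, hz, hw,
      TensorProduct.add_tmul]
  | tmul a b => simp [TensorProduct.smul_tmul']

/-- There is a channel from `𝓛(X)` to `𝓛(R')`, in Kraus form, unless `R'` is zero and `X` is not. -/
lemma exists_kraus_of_nontrivial_or_subsingleton {X : Type*} [NormedAddCommGroup X]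
    [InnerProductSpace ℂ X] [FiniteDimensional ℂ X] (h : Nontrivial R' ∨ Subsingleton X) :
    ∃ (m : ℕ) (J : Fin m → X →ₗ[ℂ] R'),
      ∑ k, LinearMap.adjoint (J k) ∘ₗ J k = LinearMap.id := by
  rcases h with h | h
  · obtain ⟨s, hs⟩ := exists_norm_eq R' zero_le_one
    refine ⟨_, fun k => ketBra s (stdOrthonormalBasis ℂ X k), ?_⟩
    rw [← sum_ketBra_self (stdOrthonormalBasis ℂ X)]
    refine Finset.sum_congr rfl fun k _ => ?_
    rw [adjoint_ketBra, comp_ketBra]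
    simp [inner_self_eq_norm_sq_to_K, hs]
  · exact ⟨0, Fin.elim0, Subsingleton.elim _ _⟩

end Sequential

section Forward

variable {H : Type*} [NormedAddCommGroup H] [InnerProductSpace ℂ H] [FiniteDimensional ℂ H]
  {K : Type*} [NormedAddCommGroup K] [InnerProductSpace ℂ K] [FiniteDimensional ℂ K]
  {n : ℕ} {L R : Fin n → Type}
  [∀ i, NormedAddCommGroup (L i)] [∀ i, InnerProductSpace ℂ (L i)]
  [∀ i, FiniteDimensional ℂ (L i)]
  [∀ i, NormedAddCommGroup (R i)] [∀ i, InnerProductSpace ℂ (R i)]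
  [∀ i, FiniteDimensional ℂ (R i)]
  (U : H ≃ₗᵢ[ℂ] PiLp 2 (fun i => L i ⊗[ℂ] R i))

/-- Heisenberg picture of semi-causality: the adjoint of the channel maps `B` into `A'`. -/
lemma exists_sum_adjoint_comp_blockOp {m : ℕ} {L' R' : Fin m → Type}
    [∀ i, NormedAddCommGroup (L' i)] [∀ i, InnerProductSpace ℂ (L' i)]
    [∀ i, FiniteDimensional ℂ (L' i)]
    [∀ i, NormedAddCommGroup (R' i)] [∀ i, InnerProductSpace ℂ (R' i)]
    [∀ i, FiniteDimensional ℂ (R' i)]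
    (U' : K ≃ₗᵢ[ℂ] PiLp 2 (fun i => L' i ⊗[ℂ] R' i)) {ι : Type*} [Fintype ι]
    (V : ι → H →ₗ[ℂ] K) (E' : (∀ i, L i →ₗ[ℂ] L i) →ₗ[ℂ] (∀ j, L' j →ₗ[ℂ] L' j))
    (h : traceCommutant U' ∘ₗ (∑ e, conj (V e)) = E' ∘ₗ traceCommutant U)
    (b : ∀ j, L' j →ₗ[ℂ] L' j) :
    ∃ c, ∑ e, LinearMap.adjoint (V e) ∘ₗ blockOp U' b ∘ₗ V e = blockOp U c := by
  let φ : (∀ i, L i →ₗ[ℂ] L i) →ₗ[ℂ] ℂ :=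
    (∑ j, LinearMap.trace ℂ (L' j) ∘ₗ LinearMap.mulLeft ℂ (A := Module.End ℂ (L' j)) (b j) ∘ₗ
      LinearMap.proj j) ∘ₗ E'
  have hφ : ∀ ρ, φ ρ = ∑ j, LinearMap.trace ℂ (L' j) (b j ∘ₗ E' ρ j) := by
    intro ρ
    simp only [φ, LinearMap.comp_apply, LinearMap.sum_apply, LinearMap.mulLeft_apply,
      LinearMap.proj_apply]
    rfl
  choose c hc using fun i => exists_trace_comp_eq
    (φ ∘ₗ LinearMap.single ℂ (fun i => L i →ₗ[ℂ] L i) i)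
  refine ⟨c, eq_of_trace_comp_eq fun ρ => ?_⟩
  rw [← trace_sum_conj, ← trace_comp_traceCommutant, ← trace_comp_traceCommutant]
  have h1 : traceCommutant U' ((∑ e, conj (V e)) ρ) = E' (traceCommutant U ρ) :=
    LinearMap.congr_fun h ρ
  rw [h1, ← hφ]
  simp only [hc, LinearMap.comp_apply, ← map_sum, LinearMap.coe_single]
  rw [Finset.univ_sum_single]

variable {L' R' : Type}
  [NormedAddCommGroup L'] [InnerProductSpace ℂ L'] [FiniteDimensional ℂ L']
  [NormedAddCommGroup R'] [InnerProductSpace ℂ R'] [FiniteDimensional ℂ R']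

/-- The Stinespring operator `H → L' ⊗ M`, `M = ⨁ₑ R'`, of the Kraus operators `ζ Vₑ`. -/
def stinespring {N : ℕ} (ζ : K →ₗᵢ[ℂ] L' ⊗[ℂ] R') (V : Fin N → H →ₗ[ℂ] K) :
    H →ₗ[ℂ] L' ⊗[ℂ] PiLp 2 (fun _ : Fin N => R') :=
  ∑ e, LinearMap.lTensor L' (incl (fun _ : Fin N => R') e) ∘ₗ ζ.toLinearMap ∘ₗ V e

lemma lTensor_proj_comp_stinespring {N : ℕ} (ζ : K →ₗᵢ[ℂ] L' ⊗[ℂ] R')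
    (V : Fin N → H →ₗ[ℂ] K) (e : Fin N) :
    LinearMap.lTensor L' (proj (fun _ : Fin N => R') e) ∘ₗ stinespring ζ V =
      ζ.toLinearMap ∘ₗ V e := by
  rw [stinespring, comp_sum, Finset.sum_eq_single e]
  · rw [← LinearMap.comp_assoc, ← LinearMap.lTensor_comp, proj_comp_incl, LinearMap.lTensor_id,
      LinearMap.id_comp]
  · intro j _ hj
    rw [← LinearMap.comp_assoc, ← LinearMap.lTensor_comp, proj_comp_incl_ne hj.symm,
      LinearMap.lTensor_zero, LinearMap.zero_comp]
  · simp

lemma adjoint_stinespring_comp {N : ℕ} (ζ : K →ₗᵢ[ℂ] L' ⊗[ℂ] R')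
    (V : Fin N → H →ₗ[ℂ] K) (b : L' →ₗ[ℂ] L') :
    LinearMap.adjoint (stinespring ζ V) ∘ₗ LinearMap.rTensor _ b ∘ₗ stinespring ζ V =
      ∑ e, LinearMap.adjoint (V e) ∘ₗ (dagger ζ ∘ₗ LinearMap.rTensor R' b ∘ₗ ζ.toLinearMap) ∘ₗ
        V e := by
  have hadj : LinearMap.adjoint (stinespring ζ V) = ∑ e, LinearMap.adjoint (V e) ∘ₗ dagger ζ ∘ₗ
      LinearMap.lTensor L' (proj (fun _ : Fin N => R') e) := by
    have h := adjoint_incl (F := fun _ : Fin N => R')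
    simp [stinespring, LinearMap.adjoint_comp, dagger, LinearMap.comp_assoc, h]
  rw [hadj, sum_comp]
  refine Finset.sum_congr rfl fun e _ => ?_
  have h : LinearMap.lTensor L' (proj (fun _ : Fin N => R') e) ∘ₗ LinearMap.rTensor _ b =
      LinearMap.rTensor R' b ∘ₗ LinearMap.lTensor L' (proj (fun _ : Fin N => R') e) := by
    rw [LinearMap.lTensor_comp_rTensor, LinearMap.rTensor_comp_lTensor]
  simp only [LinearMap.comp_assoc]
  rw [← LinearMap.comp_assoc (stinespring ζ V), h, LinearMap.comp_assoc,
    lTensor_proj_comp_stinespring]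

lemma inner_contractLeft {M : Type*} [NormedAddCommGroup M] [InnerProductSpace ℂ M]
    [FiniteDimensional ℂ M] (S : H →ₗ[ℂ] L' ⊗[ℂ] M) (k k' : L') (x x' : H) :
    inner ℂ (contractLeft M k (S x)) (contractLeft M k' (S x')) =
      inner ℂ x ((LinearMap.adjoint S ∘ₗ LinearMap.rTensor M (ketBra k k') ∘ₗ S) x') := by
  rw [← insertLeft_comp_contractLeft]
  simp only [LinearMap.comp_apply]
  rw [LinearMap.adjoint_inner_right, ← adjoint_contractLeft, LinearMap.adjoint_inner_right]

variable {M Y : Type} [NormedAddCommGroup M] [InnerProductSpace ℂ M] [FiniteDimensional ℂ M]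
  [NormedAddCommGroup Y] [InnerProductSpace ℂ Y] [FiniteDimensional ℂ Y]

/-- The first step of the factorisation: it prepares the vector `rᵢ` in place of the content of
`Rᵢ` and applies the Stinespring operator `S`. -/
def firstStep (S : H →ₗ[ℂ] L' ⊗[ℂ] M) (r : ∀ i, R i) : PiLp 2 L →ₗ[ℂ] L' ⊗[ℂ] M :=
  ∑ i, S ∘ₗ LinearMap.adjoint (component U i) ∘ₗ insertRight (L i) (r i) ∘ₗ proj L i

lemma firstStep_incl (S : H →ₗ[ℂ] L' ⊗[ℂ] M) (r : ∀ i, R i) (i : Fin n) (l : L i) :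
    firstStep U S r (incl L i l) = S (LinearMap.adjoint (component U i) (l ⊗ₜ r i)) := by
  simp only [firstStep, LinearMap.sum_apply, LinearMap.comp_apply]
  rw [Finset.sum_eq_single i]
  · simp
  · intro j _ hj
    simp [hj.symm]
  · simp

lemma adjoint_comp_firstStep (S : H →ₗ[ℂ] L' ⊗[ℂ] M)
    (hS : LinearMap.adjoint S ∘ₗ S = LinearMap.id) (r : ∀ i, R i) (hr : ∀ i, ‖r i‖ = 1) :
    LinearMap.adjoint (firstStep U S r) ∘ₗ firstStep U S r = LinearMap.id := by
  have hadj : LinearMap.adjoint (firstStep U S r) = ∑ i, incl L i ∘ₗ contractRight (L i) (r i) ∘ₗ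
      component U i ∘ₗ LinearMap.adjoint S := by
    simp [firstStep, LinearMap.adjoint_comp, LinearMap.comp_assoc, adjoint_insertRight]
  rw [← sum_incl_comp_proj (F := L), hadj, sum_comp]
  refine Finset.sum_congr rfl fun i _ => ?_
  simp only [firstStep, comp_sum, LinearMap.comp_assoc]
  rw [Finset.sum_eq_single i]
  · congr 1
    rw [← LinearMap.comp_assoc _ _ (LinearMap.adjoint S), hS, LinearMap.id_comp,
      ← LinearMap.comp_assoc _ _ (component U i), component_comp_adjoint, LinearMap.id_comp,
      ← LinearMap.comp_assoc]
    ext x : 1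
    simp [hr]
  · intro j _ hj
    rw [← LinearMap.comp_assoc _ _ (LinearMap.adjoint S), hS, LinearMap.id_comp,
      ← LinearMap.comp_assoc _ _ (component U i), component_comp_adjoint_ne U hj.symm,
      LinearMap.zero_comp, LinearMap.comp_zero, LinearMap.comp_zero]
  · simp

/-- An operator out of `H` that factors through `M ⊗ R` can be recognised on the vectors
`⟨k| W l ⊗ s` with `l` in `Lᵢ` and `s` in `Rᵢ`. -/
lemma lTensor_comp_assoc_comp_rTensor_eq (W : PiLp 2 L →ₗ[ℂ] L' ⊗[ℂ] M)
    (T : M ⊗[ℂ] PiLp 2 R →ₗ[ℂ] Y) (S : H →ₗ[ℂ] L' ⊗[ℂ] Y)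
    (h : ∀ k i l s, T (contractLeft M k (W (incl L i l)) ⊗ₜ[ℂ] incl R i s) =
      contractLeft Y k (S (LinearMap.adjoint (component U i) (l ⊗ₜ[ℂ] s)))) :
    LinearMap.lTensor L' T ∘ₗ (TensorProduct.assoc ℂ L' M (PiLp 2 R)).toLinearMap ∘ₗ
      LinearMap.rTensor (PiLp 2 R) W ∘ₗ splittingOp U = S := by
  have h1 : ∀ i, LinearMap.lTensor L' T ∘ₗ (TensorProduct.assoc ℂ L' M (PiLp 2 R)).toLinearMap
      ∘ₗ LinearMap.rTensor (PiLp 2 R) W ∘ₗ TensorProduct.map (incl L i) (incl R i) =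
      S ∘ₗ LinearMap.adjoint (component U i) := by
    refine fun i => TensorProduct.ext' fun l s => eq_of_contractLeft_eq fun k => ?_
    simp only [LinearMap.comp_apply, TensorProduct.map_tmul, LinearMap.rTensor_tmul,
      LinearEquiv.coe_coe, contractLeft_lTensor, contractLeft_assoc]
    exact h k i l s
  calc _ = ∑ i, (LinearMap.lTensor L' T ∘ₗ (TensorProduct.assoc ℂ L' M (PiLp 2 R)).toLinearMap
        ∘ₗ LinearMap.rTensor (PiLp 2 R) W ∘ₗ TensorProduct.map (incl L i) (incl R i)) ∘ₗ
          component U i := by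
        simp only [splittingOp, comp_sum, LinearMap.comp_assoc]
    _ = S := by
        simp only [h1, LinearMap.comp_assoc]
        rw [← comp_sum, sum_adjoint_comp_component, LinearMap.comp_id]

/-- If the Heisenberg dual of the channel with Stinespring operator `S` takes its values in the
operators `⨁ᵢ cᵢ ⊗ 1`, then replacing the content of `Rᵢ` by the unit vector `rᵢ` and keeping a
copy of it does not change the inner products of the partial contractions of `S`. -/
lemma inner_firstStep_tmul (S : H →ₗ[ℂ] L' ⊗[ℂ] M)
    (h : ∀ b : L' →ₗ[ℂ] L', ∃ c,
      LinearMap.adjoint S ∘ₗ LinearMap.rTensor M b ∘ₗ S = blockOp U c)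
    (r : ∀ i, R i) (hr : ∀ i, ‖r i‖ = 1) (k k' : L') (i j : Fin n) (l : L i) (s : R i)
    (l' : L j) (s' : R j) :
    inner ℂ (contractLeft M k (firstStep U S r (incl L i l)) ⊗ₜ[ℂ] incl R i s)
      (contractLeft M k' (firstStep U S r (incl L j l')) ⊗ₜ[ℂ] incl R j s') =
    inner ℂ (contractLeft M k (S (LinearMap.adjoint (component U i) (l ⊗ₜ[ℂ] s))))
      (contractLeft M k' (S (LinearMap.adjoint (component U j) (l' ⊗ₜ[ℂ] s')))) := by
  obtain ⟨c, hc⟩ := h (ketBra k k')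
  have hSC : ∀ (x : L i ⊗[ℂ] R i) (y : L j ⊗[ℂ] R j),
      inner ℂ (contractLeft M k (S (LinearMap.adjoint (component U i) x)))
        (contractLeft M k' (S (LinearMap.adjoint (component U j) y))) =
      inner ℂ x (LinearMap.rTensor (R i) (c i)
        ((component U i ∘ₗ LinearMap.adjoint (component U j)) y)) := by
    intro x y
    rw [inner_contractLeft, hc, LinearMap.adjoint_inner_left]
    congr 1
    exact LinearMap.congr_fun (component_comp_blockOp U c i) _
  rw [TensorProduct.inner_tmul, firstStep_incl, firstStep_incl, hSC, hSC]
  by_cases hij : i = j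
  · subst hij
    rw [component_comp_adjoint, ← LinearMap.adjoint_inner_right, adjoint_incl]
    simp [hr]
  · rw [component_comp_adjoint_ne U hij]
    simp

/-- Let `S : H → L' ⊗ M` be the Stinespring operator of the channel. The first step prepares a
fixed unit vector `rᵢ` in place of the content of `Rᵢ` and applies `S`. By equality of Gram
matrices a partial isometry `M ⊗ R → M` restores `S`; the second step applies it and discards the
environment. The operators `pₑ` are the coordinates of `M`, a direct sum of copies of `R'`. -/
theorem isSemiLocalisable_of_stinespring [∀ i, Nontrivial (R i)] {ι : Type*} [Fintype ι]
    (ζ : K →ₗᵢ[ℂ] L' ⊗[ℂ] R') (V : ι → H →ₗ[ℂ] K) (S : H →ₗ[ℂ] L' ⊗[ℂ] M)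
    (hS : LinearMap.adjoint S ∘ₗ S = LinearMap.id) (p : ι → M →ₗ[ℂ] R')
    (hp : ∑ e, LinearMap.adjoint (p e) ∘ₗ p e = LinearMap.id)
    (hpS : ∀ e, LinearMap.lTensor L' (p e) ∘ₗ S = ζ.toLinearMap ∘ₗ V e)
    (h : ∀ b : L' →ₗ[ℂ] L', ∃ c,
      LinearMap.adjoint S ∘ₗ LinearMap.rTensor M b ∘ₗ S = blockOp U c) :
    IsSemiLocalisable (∑ e, conj (V e)) (splitting U) ζ := by
  choose r hr using fun i => exists_norm_eq (R i) zero_le_one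
  have hgram := inner_firstStep_tmul U S h r hr
  have hWW := adjoint_comp_firstStep U S hS r hr
  generalize firstStep U S r = W at hgram hWW
  obtain ⟨T, G, hT, hG, hTG⟩ := exists_partialIsometry
    (fun p : L' × (Σ i, L i × R i) =>
      (contractLeft M p.1 (W (incl L p.2.1 p.2.2.1)) ⊗ₜ[ℂ] incl R p.2.1 p.2.2.2 :
        M ⊗[ℂ] PiLp 2 R))
    (fun p => contractLeft M p.1
      (S (LinearMap.adjoint (component U p.2.1) (p.2.2.1 ⊗ₜ[ℂ] p.2.2.2))))
    fun _ _ => hgram _ _ _ _ _ _ _ _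
  -- If `R' = 0` then `M = 0`, as `M` embeds in a direct sum of copies of `R'`.
  have htriv : Nontrivial R' ∨ Subsingleton (M ⊗[ℂ] PiLp 2 R) := by
    rcases subsingleton_or_nontrivial R' with h0 | h0
    · right
      have hid : (LinearMap.id : M →ₗ[ℂ] M) = 0 := by
        rw [← hp]
        exact Finset.sum_eq_zero fun e _ => by rw [Subsingleton.elim (p e) 0, LinearMap.comp_zero]
      refine subsingleton_of_forall_eq 0 fun x => ?_
      have := LinearMap.congr_fun (congrArg (LinearMap.rTensor (PiLp 2 R)) hid) x
      simpa using this
    · exact Or.inl h0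
  -- On the complement of the range of the first step the second step is an arbitrary channel.
  obtain ⟨m, J, hJ⟩ := exists_kraus_of_nontrivial_or_subsingleton htriv
  let Q : ι ⊕ Fin m → (M ⊗[ℂ] PiLp 2 R →ₗ[ℂ] R') :=
    Sum.elim (fun e => p e ∘ₗ T) (fun k => J k ∘ₗ G)
  have hQ : ∑ k, LinearMap.adjoint (Q k) ∘ₗ Q k = LinearMap.id := by
    have h1 : ∀ e, LinearMap.adjoint (Q (Sum.inl e)) ∘ₗ Q (Sum.inl e) =
        LinearMap.adjoint T ∘ₗ (LinearMap.adjoint (p e) ∘ₗ p e) ∘ₗ T := fun e => by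
      simp only [Q, Sum.elim_inl, LinearMap.adjoint_comp, LinearMap.comp_assoc]
    have h2 : ∀ k, LinearMap.adjoint (Q (Sum.inr k)) ∘ₗ Q (Sum.inr k) =
        LinearMap.adjoint G ∘ₗ (LinearMap.adjoint (J k) ∘ₗ J k) ∘ₗ G := fun e => by
      simp only [Q, Sum.elim_inr, LinearMap.adjoint_comp, LinearMap.comp_assoc]
    rw [Fintype.sum_sum_type]
    simp only [h1, h2]
    rw [← comp_sum, ← comp_sum, ← sum_comp, ← sum_comp, hp, hJ, LinearMap.id_comp,
      LinearMap.id_comp, hTG]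
  have hTD := lTensor_comp_assoc_comp_rTensor_eq U W T S fun k i l s => hT ⟨k, i, l, s⟩
  have hGD := lTensor_comp_assoc_comp_rTensor_eq U W G 0 fun k i l s => by
    rw [hG ⟨k, i, l, s⟩, LinearMap.zero_apply, map_zero]
  have hF : sequential (conj W) (∑ k, conj (Q k)) ∘ₗ conj (splittingOp U) =
      conj ζ.toLinearMap ∘ₗ ∑ e, conj (V e) := by
    have h1 : ∀ e, LinearMap.lTensor L' (Q (Sum.inl e)) ∘ₗ
        (TensorProduct.assoc ℂ L' M (PiLp 2 R)).toLinearMap ∘ₗ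
          LinearMap.rTensor (PiLp 2 R) W ∘ₗ splittingOp U = ζ.toLinearMap ∘ₗ V e := fun e => by
      simp only [Q, Sum.elim_inl, LinearMap.lTensor_comp]
      rw [LinearMap.comp_assoc, hTD, hpS]
    have h2 : ∀ k, LinearMap.lTensor L' (Q (Sum.inr k)) ∘ₗ
        (TensorProduct.assoc ℂ L' M (PiLp 2 R)).toLinearMap ∘ₗ
          LinearMap.rTensor (PiLp 2 R) W ∘ₗ splittingOp U = 0 := fun k => by
      simp only [Q, Sum.elim_inr, LinearMap.lTensor_comp]
      rw [LinearMap.comp_assoc, hGD, LinearMap.comp_zero]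
    rw [sequential_conj, sum_comp, comp_sum, Fintype.sum_sum_type]
    simp only [conj_comp, LinearMap.comp_assoc, h1, h2]
    rw [Finset.sum_eq_zero (s := (Finset.univ : Finset (Fin m)))
      fun k _ => LinearMap.ext fun ρ => ?_, add_zero]
    rw [conj_apply, LinearMap.zero_comp, LinearMap.zero_apply]
  refine ⟨M, inferInstance, inferInstance, inferInstance, conj W, ∑ k, conj (Q k), ?_,
    isChannel_sum_conj hQ, ?_, ?_⟩
  · have := isChannel_sum_conj (V := fun _ : Unit => W) (by simpa using hWW)
    simpa using this
  · rw [toLinearMap_splitting, hF, ← LinearMap.comp_assoc, conj_comp, dagger_comp]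
    refine LinearMap.ext fun ρ => ?_
    simp [conj_apply]
  · rw [toLinearMap_splitting, hF, ← LinearMap.comp_assoc, conj_comp, imageProj,
      LinearMap.comp_assoc, dagger_comp, LinearMap.comp_id]

/-- A channel with Kraus operators `Vₑ` is semi-localisable from `splitting U` to `ζ` if its
Heisenberg dual maps every operator `ζ† (b ⊗ 1) ζ` into the algebra represented by
`splitting U`. -/
theorem isSemiLocalisable_of_adjoint [∀ i, Nontrivial (R i)] {N : ℕ}
    (ζ : K →ₗᵢ[ℂ] L' ⊗[ℂ] R') (V : Fin N → H →ₗ[ℂ] K)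
    (hV : ∑ e, LinearMap.adjoint (V e) ∘ₗ V e = LinearMap.id)
    (h : ∀ b : L' →ₗ[ℂ] L', ∃ c, ∑ e, LinearMap.adjoint (V e) ∘ₗ
      (dagger ζ ∘ₗ LinearMap.rTensor R' b ∘ₗ ζ.toLinearMap) ∘ₗ V e = blockOp U c) :
    IsSemiLocalisable (∑ e, conj (V e)) (splitting U) ζ := by
  refine isSemiLocalisable_of_stinespring U ζ V (stinespring ζ V) ?_
    (proj (fun _ : Fin N => R')) ?_ (lTensor_proj_comp_stinespring ζ V) fun b => ?_
  · have := adjoint_stinespring_comp ζ V LinearMap.id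
    simpa [dagger_comp, hV] using this
  · simp only [adjoint_proj]
    exact sum_incl_comp_proj
  · rw [adjoint_stinespring_comp]
    exact h b

end Forward

/-! ### The double commutant theorem -/

section DoubleCommutant

variable {H : Type*} [NormedAddCommGroup H] [InnerProductSpace ℂ H] [FiniteDimensional ℂ H]

lemma mem_commutant_iff {B : StarSubalgebra ℂ (H →ₗ[ℂ] H)} {c : H →ₗ[ℂ] H} :
    c ∈ commutant B ↔ ∀ b ∈ B, b * c = c * b := by
  rw [commutant, StarSubalgebra.mem_centralizer_iff]
  exact ⟨fun h b hb => (h b hb).1, fun h b hb => ⟨h b hb, h _ (star_mem hb)⟩⟩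

lemma le_commutant_commutant (B : StarSubalgebra ℂ (H →ₗ[ℂ] H)) :
    B ≤ commutant (commutant B) := fun _ hb =>
  mem_commutant_iff.2 fun _ hc => (mem_commutant_iff.1 hc _ hb).symm

/-- An operator commutes with the projector on a subspace that is invariant under the operator and
under its adjoint. -/
lemma comp_starProjection_of_invariant (S : Submodule ℂ H) (b : H →ₗ[ℂ] H)
    (h : ∀ x ∈ S, b x ∈ S) (h' : ∀ x ∈ S, LinearMap.adjoint b x ∈ S) :
    b ∘ₗ S.starProjection.toLinearMap = S.starProjection.toLinearMap ∘ₗ b := by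
  refine LinearMap.ext fun x => ?_
  have h1 : S.starProjection (b (S.starProjection x)) = b (S.starProjection x) :=
    Submodule.starProjection_eq_self_iff.2 (h _ (S.starProjection_apply_mem x))
  have h2 : S.starProjection (b (x - S.starProjection x)) = 0 := by
    rw [Submodule.starProjection_apply_eq_zero_iff]
    intro y hy
    rw [← LinearMap.adjoint_inner_left]
    exact S.sub_starProjection_mem_orthogonal x _ (h' y hy)
  rw [map_sub, map_sub, sub_eq_zero, h1] at h2
  exact h2.symm

lemma starProjection_mem_commutant (B : StarSubalgebra ℂ (H →ₗ[ℂ] H)) (S : Submodule ℂ H)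
    (h : ∀ b ∈ B, ∀ x ∈ S, b x ∈ S) : S.starProjection.toLinearMap ∈ commutant B :=
  mem_commutant_iff.2 fun b hb =>
    comp_starProjection_of_invariant S b (h b hb) (h _ (star_mem hb))

/-- The operator `b ⊕ ⋯ ⊕ b` on `H ⊕ ⋯ ⊕ H`. -/
def amplify (N : ℕ) (b : H →ₗ[ℂ] H) :
    PiLp 2 (fun _ : Fin N => H) →ₗ[ℂ] PiLp 2 (fun _ : Fin N => H) :=
  blockDiag (F := fun _ : Fin N => H) fun _ => b

lemma amplify_apply {N : ℕ} (b : H →ₗ[ℂ] H) (z : PiLp 2 (fun _ : Fin N => H)) (k : Fin N) :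
    amplify N b z k = b (z k) :=
  LinearMap.congr_fun (proj_comp_blockDiag (F := fun _ : Fin N => H) (fun _ => b) k) z

lemma adjoint_amplify {N : ℕ} (b : H →ₗ[ℂ] H) :
    LinearMap.adjoint (amplify N b) = amplify N (LinearMap.adjoint b) := by
  symm
  rw [LinearMap.eq_adjoint_iff]
  intro x y
  rw [PiLp.inner_apply, PiLp.inner_apply]
  simp only [amplify_apply, LinearMap.adjoint_inner_left]

/-- An operator on `H ⊕ ⋯ ⊕ H` that commutes with `b ⊕ ⋯ ⊕ b` for all `b` in `B` has its matrix
entries in the commutant of `B`, so it commutes with `T ⊕ ⋯ ⊕ T` for all `T` in the double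
commutant. -/
lemma amplify_comp_comm (B : StarSubalgebra ℂ (H →ₗ[ℂ] H)) {N : ℕ}
    (P : PiLp 2 (fun _ : Fin N => H) →ₗ[ℂ] PiLp 2 (fun _ : Fin N => H))
    (hP : ∀ b ∈ B, amplify N b ∘ₗ P = P ∘ₗ amplify N b) {T : H →ₗ[ℂ] H}
    (hT : T ∈ commutant (commutant B)) : amplify N T ∘ₗ P = P ∘ₗ amplify N T := by
  let c : Fin N → Fin N → H →ₗ[ℂ] H := fun k l =>
    proj (fun _ : Fin N => H) k ∘ₗ P ∘ₗ incl (fun _ : Fin N => H) l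
  have hc : ∀ k l v, P (incl (fun _ : Fin N => H) l v) k = c k l v := fun k l v => rfl
  have hincl : ∀ (b : H →ₗ[ℂ] H) l v, amplify N b (incl (fun _ : Fin N => H) l v) =
      incl (fun _ : Fin N => H) l (b v) := fun b l v =>
    LinearMap.congr_fun (blockDiag_comp_incl (F := fun _ : Fin N => H) (fun _ => b) l) v
  have hcomm : ∀ k l, c k l ∈ commutant B := by
    refine fun k l => mem_commutant_iff.2 fun b hb => LinearMap.ext fun v => ?_
    have h := congrArg (fun z : PiLp 2 (fun _ : Fin N => H) => z k)
      (LinearMap.congr_fun (hP b hb) (incl (fun _ : Fin N => H) l v))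
    simp only [LinearMap.comp_apply, amplify_apply, hincl, hc] at h
    exact h
  refine LinearMap.ext fun z => ?_
  rw [← sum_incl_apply z, map_sum, map_sum]
  refine Finset.sum_congr rfl fun l _ => PiLp.ext fun k => ?_
  simp only [LinearMap.comp_apply, amplify_apply, hincl, hc]
  exact (LinearMap.congr_fun (mem_commutant_iff.1 hT _ (hcomm k l)) (z l)).symm

/-- Let `T` commute with the commutant of `B` and let `x₁, …, x_N` be a basis of `H`. The subspace
`{(b x₁, …, b x_N) | b ∈ B}` of `H ⊕ ⋯ ⊕ H` is invariant under `B`, so its projector commutes with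
`T ⊕ ⋯ ⊕ T` and it is invariant under `T ⊕ ⋯ ⊕ T`, which gives `T ∈ B`. -/
theorem commutant_commutant (B : StarSubalgebra ℂ (H →ₗ[ℂ] H)) :
    commutant (commutant B) = B := by
  refine le_antisymm (fun T hT => ?_) (le_commutant_commutant B)
  let N := Module.finrank ℂ H
  let x : OrthonormalBasis (Fin N) ℂ H := stdOrthonormalBasis ℂ H
  let ev : (H →ₗ[ℂ] H) →ₗ[ℂ] PiLp 2 (fun _ : Fin N => H) :=
    { toFun := fun b => WithLp.toLp 2 fun k => b (x k)
      map_add' := fun b c => rfl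
      map_smul' := fun z b => rfl }
  have hev : ∀ b k, ev b k = b (x k) := fun b k => rfl
  have hmul : ∀ b c, amplify N b (ev c) = ev (b * c) := fun b c =>
    PiLp.ext fun k => amplify_apply _ _ _
  let S : Submodule ℂ (PiLp 2 (fun _ : Fin N => H)) := B.toSubalgebra.toSubmodule.map ev
  have hS : ∀ z, z ∈ S ↔ ∃ b ∈ B, ev b = z := fun z => Iff.rfl
  have hinv : ∀ b ∈ B, ∀ z ∈ S, amplify N b z ∈ S := by
    intro b hb z hz
    obtain ⟨c, hc, rfl⟩ := (hS z).1 hz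
    exact (hS _).2 ⟨b * c, mul_mem hb hc, (hmul b c).symm⟩
  have hTP := amplify_comp_comm B S.starProjection.toLinearMap (fun b hb =>
    comp_starProjection_of_invariant S _ (hinv b hb) (by
      rw [adjoint_amplify]
      exact hinv _ (star_mem hb))) hT
  have hmem : ev 1 ∈ S := (hS _).2 ⟨1, one_mem B, rfl⟩
  have hTmem : ev T ∈ S := by
    have h : amplify N T (S.starProjection (ev 1)) = S.starProjection (amplify N T (ev 1)) :=
      LinearMap.congr_fun hTP (ev 1)
    rw [Submodule.starProjection_eq_self_iff.2 hmem, hmul, mul_one] at h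
    rw [h]
    exact S.starProjection_apply_mem _
  obtain ⟨b, hb, hbT⟩ := (hS _).1 hTmem
  have : T = b := x.toBasis.ext fun k => by
    rw [OrthonormalBasis.coe_toBasis, ← hev, ← hev, hbT]
  exact this ▸ hb

end DoubleCommutant

/-! ### Minimal projections -/

section MinimalProjections

variable {H : Type*} [NormedAddCommGroup H] [InnerProductSpace ℂ H] [FiniteDimensional ℂ H]

/-- A non-zero projection `p` in the algebra `C` with `p C p = ℂ p`. -/
structure IsMinimalProjection (C : StarSubalgebra ℂ (H →ₗ[ℂ] H)) (p : H →ₗ[ℂ] H) : Prop where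
  mem : p ∈ C
  isStarProjection : IsStarProjection p
  ne_zero : p ≠ 0
  minimal : ∀ c ∈ C, ∃ z : ℂ, p * c * p = z • p

lemma isStarProjection_starProjection (S : Submodule ℂ H) :
    IsStarProjection (S.starProjection.toLinearMap : H →ₗ[ℂ] H) where
  isIdempotentElem := LinearMap.ext fun x =>
    Submodule.starProjection_eq_self_iff.2 (S.starProjection_apply_mem x)
  isSelfAdjoint := by
    rw [IsSelfAdjoint, LinearMap.star_eq_adjoint, eq_comm, LinearMap.eq_adjoint_iff]
    exact fun x y => S.inner_starProjection_left_eq_right x y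

/-- An eigenspace of a non-scalar operator of `q B' q` gives a proper subprojection of a
projection `q` of `B'` that is not minimal. -/
lemma exists_subprojection (B : StarSubalgebra ℂ (H →ₗ[ℂ] H)) {q : H →ₗ[ℂ] H}
    (hq : q ∈ commutant B) (hqp : IsStarProjection q) (h0 : q ≠ 0)
    (hmin : ¬ IsMinimalProjection (commutant B) q) :
    ∃ S : Submodule ℂ H, S ≠ ⊥ ∧ S < LinearMap.range q ∧
      S.starProjection.toLinearMap ∈ commutant B := by
  obtain ⟨c, hc, hcz⟩ : ∃ c ∈ commutant B, ∀ z : ℂ, q * c * q ≠ z • q := by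
    by_contra! hcon
    exact hmin ⟨hq, hqp, h0, hcon⟩
  have hqq : ∀ v, q (q v) = q v := fun v => LinearMap.congr_fun hqp.isIdempotentElem v
  have hrange : ∀ v ∈ LinearMap.range q, q v = v := by
    rintro _ ⟨w, rfl⟩
    exact hqq w
  let y : Module.End ℂ (LinearMap.range q) := (q * c * q).restrict
    (p := LinearMap.range q) (q := LinearMap.range q) fun v _ => ⟨_, rfl⟩
  have : Nontrivial (LinearMap.range q) :=
    Submodule.nontrivial_iff_ne_bot.2 fun h => h0 (LinearMap.range_eq_bot.1 h)
  obtain ⟨z, hz⟩ := Module.End.exists_eigenvalue y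
  obtain ⟨w, hw, hw0⟩ := hz.exists_hasEigenvector
  have hwz : (q * c * q) w = z • (w : H) := by
    have := congrArg Subtype.val (Module.End.mem_eigenspace_iff.1 hw)
    exact this
  let S : Submodule ℂ H := LinearMap.range q ⊓ LinearMap.ker (q * c * q - z • 1)
  have hS : ∀ v, v ∈ S ↔ v ∈ LinearMap.range q ∧ (q * c * q) v = z • v := fun v => by
    simp [S, sub_eq_zero]
  refine ⟨S, ?_, lt_of_le_of_ne inf_le_left ?_, starProjection_mem_commutant B S ?_⟩
  · rw [Submodule.ne_bot_iff]
    exact ⟨w, (hS _).2 ⟨w.2, hwz⟩, fun h => hw0 (Subtype.ext h)⟩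
  · intro heq
    refine hcz z (LinearMap.ext fun v => ?_)
    have hv : q v ∈ S := heq ▸ ⟨v, rfl⟩
    have := ((hS _).1 hv).2
    simp only [Module.End.mul_apply, hqq, LinearMap.smul_apply] at this ⊢
    exact this
  · intro b hb v hv
    obtain ⟨hv1, hv2⟩ := (hS v).1 hv
    have hcomm : ∀ d ∈ commutant B, d (b v) = b (d v) := fun d hd =>
      (LinearMap.congr_fun (mem_commutant_iff.1 hd b hb) v).symm
    refine (hS _).2 ⟨⟨b v, by rw [hcomm q hq, hrange v hv1]⟩, ?_⟩
    rw [hcomm _ (mul_mem (mul_mem hq hc) hq), hv2, map_smul]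

/-- A projection of the commutant of `B` is a sum of minimal projections. -/
lemma exists_sum_minimalProjections (B : StarSubalgebra ℂ (H →ₗ[ℂ] H)) (d : ℕ) :
    ∀ q ∈ commutant B, IsStarProjection q → Module.finrank ℂ (LinearMap.range q) ≤ d →
      ∃ (ι : Type) (_ : Fintype ι) (p : ι → H →ₗ[ℂ] H),
        (∀ k, IsMinimalProjection (commutant B) (p k)) ∧ ∑ k, p k = q := by
  induction d with
  | zero =>
    intro q _ _ hd
    have : q = 0 := LinearMap.range_eq_bot.1 (Submodule.finrank_eq_zero.1 (Nat.le_zero.1 hd))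
    exact ⟨Empty, inferInstance, Empty.elim, fun k => k.elim, by simp [this]⟩
  | succ d ih =>
    intro q hq hqp hd
    by_cases h0 : q = 0
    · exact ⟨Empty, inferInstance, Empty.elim, fun k => k.elim, by simp [h0]⟩
    by_cases hmin : IsMinimalProjection (commutant B) q
    · exact ⟨Unit, inferInstance, fun _ => q, fun _ => hmin, by simp⟩
    obtain ⟨S, hS0, hSq, hSB⟩ := exists_subprojection B hq hqp h0 hmin
    let s : H →ₗ[ℂ] H := S.starProjection.toLinearMap
    have hs : IsStarProjection s := isStarProjection_starProjection S
    have hqs : q * s = s := LinearMap.ext fun v => by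
      obtain ⟨w, hw⟩ := hSq.le (S.starProjection_apply_mem v)
      change q (S.starProjection v) = S.starProjection v
      rw [← hw]
      exact LinearMap.congr_fun hqp.isIdempotentElem w
    have hsq : s * q = s := by
      have := congrArg star hqs
      rwa [star_mul, hs.isSelfAdjoint.star_eq, hqp.isSelfAdjoint.star_eq] at this
    have hrs : LinearMap.range s = S := by
      refine le_antisymm ?_ fun v hv => ⟨v, Submodule.starProjection_eq_self_iff.2 hv⟩
      rintro _ ⟨v, rfl⟩
      exact S.starProjection_apply_mem v
    have hsub : IsStarProjection (q - s) := by
      refine ⟨?_, hqp.isSelfAdjoint.sub hs.isSelfAdjoint⟩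
      rw [IsIdempotentElem, mul_sub, sub_mul, sub_mul, hqs, hsq, hs.isIdempotentElem.eq,
        hqp.isIdempotentElem.eq, sub_self, sub_zero]
    have hlt : LinearMap.range (q - s) < LinearMap.range q := by
      refine lt_of_le_of_ne ?_ ?_
      · rintro _ ⟨v, rfl⟩
        refine ⟨(q - s) v, ?_⟩
        have : q * (q - s) = q - s := by rw [mul_sub, hqs, hqp.isIdempotentElem.eq]
        exact LinearMap.congr_fun this v
      · intro heq
        refine hS0 (eq_bot_iff.2 fun v hv => ?_)
        obtain ⟨w, hw⟩ := hSq.le hv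
        have : v ∈ LinearMap.range (q - s) := heq ▸ ⟨w, hw⟩
        obtain ⟨w', rfl⟩ := this
        have hzero : s * (q - s) = 0 := by rw [mul_sub, hsq, hs.isIdempotentElem.eq, sub_self]
        have h1 : s ((q - s) w') = (q - s) w' := Submodule.starProjection_eq_self_iff.2 hv
        rw [Submodule.mem_bot, ← h1]
        exact LinearMap.congr_fun hzero w'
    have hd1 := Submodule.finrank_lt_finrank_of_lt hSq
    have hd2 := Submodule.finrank_lt_finrank_of_lt hlt
    obtain ⟨ι₁, _, p₁, hp₁, hsum₁⟩ := ih s hSB hs (by rw [hrs]; omega)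
    obtain ⟨ι₂, _, p₂, hp₂, hsum₂⟩ := ih (q - s) (sub_mem hq hSB) hsub (by omega)
    refine ⟨ι₁ ⊕ ι₂, inferInstance, Sum.elim p₁ p₂, ?_, ?_⟩
    · rintro (k | k)
      · exact hp₁ k
      · exact hp₂ k
    · simp [Fintype.sum_sum_type, hsum₁, hsum₂]

lemma inner_star_mul_self (a : H →ₗ[ℂ] H) (v : H) :
    inner ℂ v ((star a * a) v) = ((‖a v‖ ^ 2 : ℝ) : ℂ) := by
  rw [Module.End.mul_apply, LinearMap.star_eq_adjoint, LinearMap.adjoint_inner_right,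
    inner_self_eq_norm_sq_to_K]
  simp

lemma star_mul_self_eq_zero_iff {a : H →ₗ[ℂ] H} : star a * a = 0 ↔ a = 0 := by
  refine ⟨fun h => LinearMap.ext fun x => ?_, fun h => by simp [h]⟩
  have h1 := inner_star_mul_self a x
  rw [h, LinearMap.zero_apply, inner_zero_right] at h1
  have h2 : ‖a x‖ ^ 2 = 0 := by exact_mod_cast h1.symm
  simpa using h2

/-- Projections that sum to `1` are orthogonal. -/
lemma mul_eq_zero_of_sum_eq_one {ι : Type*} [Fintype ι] {p : ι → H →ₗ[ℂ] H}
    (hp : ∀ k, IsStarProjection (p k)) (hsum : ∑ k, p k = 1) {k l : ι} (hkl : k ≠ l) :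
    p k * p l = 0 := by
  classical
  refine LinearMap.ext fun x => ?_
  have hinner : ∀ j, inner ℂ (p l x) (p j (p l x)) = ((‖p j (p l x)‖ ^ 2 : ℝ) : ℂ) := by
    intro j
    rw [← inner_star_mul_self, (hp j).isSelfAdjoint.star_eq, (hp j).isIdempotentElem.eq]
  have htot : ∑ j, ‖p j (p l x)‖ ^ 2 = ‖p l x‖ ^ 2 := by
    have h1 : inner ℂ (p l x) ((∑ j, p j) (p l x)) = ((‖p l x‖ ^ 2 : ℝ) : ℂ) := by
      rw [hsum, Module.End.one_apply, inner_self_eq_norm_sq_to_K]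
      simp
    rw [LinearMap.sum_apply, inner_sum] at h1
    simp only [hinner] at h1
    exact_mod_cast h1
  have hl : ‖p l (p l x)‖ ^ 2 = ‖p l x‖ ^ 2 := by
    have h : p l (p l x) = p l x := LinearMap.congr_fun (hp l).isIdempotentElem x
    rw [h]
  have hle : ‖p k (p l x)‖ ^ 2 + ‖p l (p l x)‖ ^ 2 ≤ ∑ j, ‖p j (p l x)‖ ^ 2 := by
    rw [← Finset.sum_pair hkl (f := fun j => ‖p j (p l x)‖ ^ 2)]
    exact Finset.sum_le_sum_of_subset_of_nonneg (Finset.subset_univ _) fun _ _ _ => by positivity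
  have : ‖p k (p l x)‖ ^ 2 ≤ 0 := by linarith
  have h0 : ‖p k (p l x)‖ = 0 := by nlinarith [norm_nonneg (p k (p l x))]
  exact norm_eq_zero.1 h0

/-- Two minimal projections `p`, `q` of `C` with `q C p ≠ 0` are related by a partial isometry of
`C`: a multiple of any non-zero element of `q C p`. -/
lemma exists_partialIsometry_of_ne_zero {C : StarSubalgebra ℂ (H →ₗ[ℂ] H)} {p q c : H →ₗ[ℂ] H}
    (hp : IsMinimalProjection C p) (hq : IsMinimalProjection C q) (hc : c ∈ C)
    (h0 : q * c * p ≠ 0) : ∃ u ∈ C, star u * u = p ∧ u * star u = q := by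
  let x := q * c * p
  have hpp := hp.isStarProjection.isIdempotentElem.eq
  have hps := hp.isStarProjection.isSelfAdjoint.star_eq
  have hqq := hq.isStarProjection.isIdempotentElem.eq
  have hqs := hq.isStarProjection.isSelfAdjoint.star_eq
  have hx : x ∈ C := mul_mem (mul_mem hq.mem hc) hp.mem
  have hxp : x * p = x := by simp only [x, mul_assoc, hpp]
  have hqx : q * x = x := by simp only [x, ← mul_assoc, hqq]
  have hpx : p * star x = star x := by rw [← hps, ← star_mul, hxp]
  have hxq : star x * q = star x := by rw [← hqs, ← star_mul, hqx]
  obtain ⟨z, hz⟩ := hp.minimal (star x * x) (mul_mem (star_mem hx) hx)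
  rw [← mul_assoc, hpx, mul_assoc, hxp] at hz
  obtain ⟨z', hz'⟩ := hq.minimal (x * star x) (mul_mem hx (star_mem hx))
  rw [← mul_assoc, hqx, mul_assoc, hxq] at hz'
  -- The scalar `z` is positive.
  obtain ⟨v, hv⟩ : ∃ v, x v ≠ 0 := by
    by_contra! hcon
    exact h0 (LinearMap.ext hcon)
  have hnorm : ((‖x v‖ ^ 2 : ℝ) : ℂ) = z * ((‖p v‖ ^ 2 : ℝ) : ℂ) := by
    have h2 := inner_star_mul_self p v
    rw [hps, hpp] at h2
    rw [← inner_star_mul_self, ← h2, hz, LinearMap.smul_apply, inner_smul_right]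
  have hpv : p v ≠ 0 := by
    intro h
    apply hv
    rw [← hxp, Module.End.mul_apply, h, map_zero]
  let t : ℝ := ‖x v‖ ^ 2 / ‖p v‖ ^ 2
  have ht : 0 < t := by
    have := norm_pos_iff.2 hv
    have := norm_pos_iff.2 hpv
    positivity
  have hzt : z = (t : ℂ) := by
    have : ((‖p v‖ ^ 2 : ℝ) : ℂ) ≠ 0 := by
      have := norm_pos_iff.2 hpv
      exact_mod_cast (by positivity : ‖p v‖ ^ 2 ≠ 0)
    simp only [t]
    rw [Complex.ofReal_div, hnorm, mul_div_assoc, div_self this, mul_one]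
  let r : ℝ := (Real.sqrt t)⁻¹
  have hr : (r : ℂ) * r * z = 1 := by
    have h1 : r * r * t = 1 := by
      have h2 : Real.sqrt t * Real.sqrt t = t := Real.mul_self_sqrt ht.le
      have h3 : Real.sqrt t ≠ 0 := (Real.sqrt_pos.2 ht).ne'
      simp only [r]
      nth_rewrite 3 [← h2]
      field_simp
    rw [hzt]
    exact_mod_cast h1
  let u := (r : ℂ) • x
  have hus : star u = (r : ℂ) • star x := by simp [u, star_smul]
  have huu : star u * u = p := by
    rw [hus, smul_mul_smul_comm, hz, smul_smul, hr, one_smul]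
  have hup : u * p = u := by simp only [u, smul_mul_assoc, hxp]
  refine ⟨u, SMulMemClass.smul_mem _ hx, huu, ?_⟩
  -- `u u†` is an idempotent multiple of the projection `q`.
  let w : ℂ := r * r * z'
  have huq : u * star u = w • q := by
    rw [hus, smul_mul_smul_comm, hz', smul_smul]
  have hidem : (u * star u) * (u * star u) = u * star u := by
    rw [mul_assoc, ← mul_assoc (star u), huu, ← mul_assoc, hup]
  have hne : u * star u ≠ 0 := by
    intro h
    have : star u = 0 := star_mul_self_eq_zero_iff.1 (by rw [star_star, h])
    apply hp.ne_zero
    rw [← huu, this, zero_mul]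
  rw [huq, smul_mul_smul_comm, hqq] at hidem
  have hw : w * w = w := smul_left_injective ℂ hq.ne_zero hidem
  have hw0 : w ≠ 0 := fun h => hne (by rw [huq, h, zero_smul])
  have hw1 : w = 1 := mul_left_cancel₀ hw0 (by rw [hw, mul_one])
  rw [huq, hw1, one_smul]

end MinimalProjections

/-! ### Existence of representation unitaries -/

section Existence

variable {H : Type*} [NormedAddCommGroup H] [InnerProductSpace ℂ H] [FiniteDimensional ℂ H]

/-- `u u† u = u` for a partial isometry `u` with initial projection `p`. -/
lemma mul_eq_self_of_star_mul_self {u p : H →ₗ[ℂ] H} (h : star u * u = p)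
    (hp : IsStarProjection p) : u * p = u := by
  have hpp := hp.isIdempotentElem.eq
  have hps := hp.isSelfAdjoint.star_eq
  rw [← sub_eq_zero, ← star_mul_self_eq_zero_iff, star_sub, star_mul, hps, sub_mul, mul_sub,
    mul_sub, mul_assoc p, h, ← mul_assoc _ u p, h, mul_assoc p (star u), h, hpp, hpp, sub_self]

/-- In the commutant `B'` there are partial isometries `u_k`, with mutually orthogonal final
projections that sum to `1`, whose initial projections are taken from a finite family of minimal
projections of `B'`, indexed by classes, without intertwiners between different classes. -/
lemma exists_partialIsometries (B : StarSubalgebra ℂ (H →ₗ[ℂ] H)) :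
    ∃ (ι : Type) (_ : Fintype ι) (n : ℕ) (cls : ι → Fin n) (q : Fin n → H →ₗ[ℂ] H)
      (u : ι → H →ₗ[ℂ] H), Function.Surjective cls ∧
      (∀ i, IsMinimalProjection (commutant B) (q i)) ∧ (∀ k, u k ∈ commutant B) ∧
      (∀ k, star (u k) * u k = q (cls k)) ∧ (∀ k l, k ≠ l → star (u k) * u l = 0) ∧
      ∑ k, u k * star (u k) = 1 ∧
      ∀ c ∈ commutant B, ∀ k l, cls k ≠ cls l → star (u k) * c * u l = 0 := by
  obtain ⟨ι, _, p, hp, hsum⟩ := exists_sum_minimalProjections B _ 1 (one_mem _)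
    (IsStarProjection.one _) le_rfl
  have hpp := fun k => (hp k).isStarProjection
  -- Murray-von Neumann equivalence of projections of the commutant.
  let s : Setoid ι :=
    { r := fun k l => ∃ u ∈ commutant B, star u * u = p k ∧ u * star u = p l
      iseqv :=
        { refl := fun k => ⟨p k, (hp k).mem, by
            rw [(hpp k).isSelfAdjoint.star_eq, (hpp k).isIdempotentElem.eq, and_self]⟩
          symm := by
            rintro k l ⟨u, hu, h1, h2⟩
            exact ⟨star u, star_mem hu, by rwa [star_star], by rwa [star_star]⟩
          trans := by
            rintro k l m ⟨u, hu, h1, h2⟩ ⟨v, hv, h3, h4⟩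
            have hvl := mul_eq_self_of_star_mul_self h3 (hpp l)
            have huk := mul_eq_self_of_star_mul_self h1 (hpp k)
            refine ⟨v * u, mul_mem hv hu, ?_, ?_⟩
            · rw [star_mul, mul_assoc, ← mul_assoc (star v), h3, ← h2, mul_assoc u, h1, huk, h1]
            · rw [star_mul, mul_assoc, ← mul_assoc u, h2, ← mul_assoc, hvl, h4] } }
  classical
  let e : Quotient s ≃ Fin (Fintype.card (Quotient s)) := Fintype.equivFin _
  let cls : ι → Fin (Fintype.card (Quotient s)) := fun k => e ⟦k⟧
  let rep : Fin (Fintype.card (Quotient s)) → ι := fun i => (e.symm i).out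
  have hrep : ∀ k, s.r (rep (cls k)) k := by
    intro k
    simp only [rep, cls, e.symm_apply_apply]
    exact Quotient.mk_out (s := s) k
  choose u hu huk hku using hrep
  have hpu : ∀ k, p k * u k = u k := fun k => by
    rw [← hku, mul_assoc, huk, mul_eq_self_of_star_mul_self (huk k) (hpp _)]
  have hup : ∀ k, star (u k) * p k = star (u k) := fun k => by
    conv_rhs => rw [← hpu, star_mul, (hpp k).isSelfAdjoint.star_eq]
  refine ⟨ι, inferInstance, _, cls, fun i => p (rep i), u, ?_, fun i => hp _, hu, huk, ?_, ?_, ?_⟩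
  · exact e.surjective.comp Quotient.mk_surjective
  · intro k l hkl
    rw [← hup, ← hpu l, mul_assoc, ← mul_assoc (p k), mul_eq_zero_of_sum_eq_one hpp hsum hkl,
      zero_mul, mul_zero]
  · simp only [hku, hsum]
  · intro c hc k l hkl
    have h0 : p k * c * p l = 0 := by
      by_contra h0
      obtain ⟨v, hv, h1, h2⟩ := exists_partialIsometry_of_ne_zero (hp l) (hp k) hc h0
      exact hkl (congrArg e (Quotient.sound (s := s) (⟨v, hv, h1, h2⟩ : s.r l k))).symm
    rw [← hup, ← hpu l]
    calc star (u k) * p k * c * (p l * u l) = star (u k) * (p k * c * p l) * u l := by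
          simp only [mul_assoc]
      _ = 0 := by rw [h0, mul_zero, zero_mul]

/-- An isometry onto the range of a projection. -/
lemma exists_isometry_of_isStarProjection {q : H →ₗ[ℂ] H} (hq : IsStarProjection q) :
    ∃ (d : ℕ) (J : EuclideanSpace ℂ (Fin d) →ₗ[ℂ] H),
      LinearMap.adjoint J ∘ₗ J = LinearMap.id ∧ J ∘ₗ LinearMap.adjoint J = q := by
  let J : EuclideanSpace ℂ (Fin (Module.finrank ℂ (LinearMap.range q))) →ₗᵢ[ℂ] H :=
    (LinearMap.range q).subtypeₗᵢ.comp
      (stdOrthonormalBasis ℂ (LinearMap.range q)).repr.symm.toLinearIsometry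
  refine ⟨_, J.toLinearMap, adjoint_comp_isometry J, LinearMap.ext fun x => ?_⟩
  have hs : LinearMap.adjoint q = q := hq.isSelfAdjoint.star_eq
  have hJ : q ∘ₗ J.toLinearMap = J.toLinearMap := LinearMap.ext fun w => by
    obtain ⟨v, hv⟩ : J w ∈ LinearMap.range q := Subtype.prop _
    change q (J w) = J w
    rw [← hv]
    exact LinearMap.congr_fun hq.isIdempotentElem v
  obtain ⟨w, hw⟩ : ∃ w, J w = q x := by
    refine ⟨(stdOrthonormalBasis ℂ (LinearMap.range q)).repr ⟨q x, x, rfl⟩, ?_⟩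
    simp [J]
  have h1 : LinearMap.adjoint J.toLinearMap ∘ₗ q = LinearMap.adjoint J.toLinearMap := by
    conv_rhs => rw [← hJ, LinearMap.adjoint_comp, hs]
  have h2 : LinearMap.adjoint J.toLinearMap x = w := by
    rw [← h1, LinearMap.comp_apply, ← hw]
    exact LinearMap.congr_fun (adjoint_comp_isometry J) w
  rw [LinearMap.comp_apply, h2]
  exact hw

/-- A unitary onto a direct sum, from its components. -/
lemma exists_unitary_of_components {n : ℕ} {F : Fin n → Type*} [∀ i, NormedAddCommGroup (F i)]
    [∀ i, InnerProductSpace ℂ (F i)] [∀ i, FiniteDimensional ℂ (F i)] (C : ∀ i, H →ₗ[ℂ] F i)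
    (h1 : ∀ i, C i ∘ₗ LinearMap.adjoint (C i) = LinearMap.id)
    (h2 : ∀ i j, i ≠ j → C i ∘ₗ LinearMap.adjoint (C j) = 0)
    (h3 : ∑ i, LinearMap.adjoint (C i) ∘ₗ C i = LinearMap.id) :
    ∃ U : H ≃ₗᵢ[ℂ] PiLp 2 F, ∀ x i, U x i = C i x := by
  let X : H →ₗ[ℂ] PiLp 2 F := ∑ i, incl F i ∘ₗ C i
  have hadj : LinearMap.adjoint X = ∑ i, LinearMap.adjoint (C i) ∘ₗ proj F i := by
    simp [X, LinearMap.adjoint_comp]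
  have hpX : ∀ i, proj F i ∘ₗ X = C i := by
    intro i
    simp only [X, comp_sum]
    rw [Finset.sum_eq_single i]
    · rw [← LinearMap.comp_assoc, proj_comp_incl, LinearMap.id_comp]
    · intro j _ hj
      rw [← LinearMap.comp_assoc, proj_comp_incl_ne hj.symm, LinearMap.zero_comp]
    · simp
  have hXX : LinearMap.adjoint X ∘ₗ X = LinearMap.id := by
    rw [hadj, sum_comp, ← h3]
    simp only [LinearMap.comp_assoc, hpX]
  have hXX' : X ∘ₗ LinearMap.adjoint X = LinearMap.id := by
    rw [hadj, ← sum_incl_comp_proj]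
    simp only [X, sum_comp, comp_sum, LinearMap.comp_assoc]
    refine Finset.sum_congr rfl fun i _ => ?_
    rw [Finset.sum_eq_single i]
    · rw [← LinearMap.comp_assoc _ _ (C i), h1, LinearMap.id_comp]
    · intro j _ hj
      rw [← LinearMap.comp_assoc _ _ (C j), h2 j i hj, LinearMap.zero_comp,
        LinearMap.comp_zero]
    · simp
  let U : H ≃ₗᵢ[ℂ] PiLp 2 F :=
    { toLinearEquiv := LinearEquiv.ofLinearMap X (LinearMap.adjoint X) hXX' hXX
      norm_map' := (isometryOfAdjoint X hXX).norm_map }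
  exact ⟨U, fun x i => LinearMap.congr_fun (hpX i) x⟩

variable {n : ℕ} {L R : Fin n → Type}
  [∀ i, NormedAddCommGroup (L i)] [∀ i, InnerProductSpace ℂ (L i)]
  [∀ i, FiniteDimensional ℂ (L i)]
  [∀ i, NormedAddCommGroup (R i)] [∀ i, InnerProductSpace ℂ (R i)]
  [∀ i, FiniteDimensional ℂ (R i)] {ι : Type} [Fintype ι] {cls : ι → Fin n}

/-- The component `H → Lᵢ ⊗ Rᵢ` of the unitary built from the isometries `u_k Jᵢ : Lᵢ → H`: its
adjoint maps `l ⊗ e_k` to `u_k Jᵢ l`. -/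
def isometryComponent (e : ∀ i, OrthonormalBasis {k // cls k = i} ℂ (R i))
    (J : ∀ i, L i →ₗ[ℂ] H) (u : ι → H →ₗ[ℂ] H) (i : Fin n) : H →ₗ[ℂ] L i ⊗[ℂ] R i :=
  ∑ k : {k // cls k = i}, insertRight (L i) (e i k) ∘ₗ LinearMap.adjoint (J i) ∘ₗ
    LinearMap.adjoint (u k)

lemma adjoint_isometryComponent (e : ∀ i, OrthonormalBasis {k // cls k = i} ℂ (R i))
    (J : ∀ i, L i →ₗ[ℂ] H) (u : ι → H →ₗ[ℂ] H) (i : Fin n) :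
    LinearMap.adjoint (isometryComponent e J u i) = ∑ k : {k // cls k = i},
      u k ∘ₗ J i ∘ₗ contractRight (L i) (e i k) := by
  simp [isometryComponent, LinearMap.adjoint_comp, adjoint_insertRight, LinearMap.comp_assoc]

lemma contractRight_comp_isometryComponent (e : ∀ i, OrthonormalBasis {k // cls k = i} ℂ (R i))
    (J : ∀ i, L i →ₗ[ℂ] H) (u : ι → H →ₗ[ℂ] H) (i : Fin n) (k : {k // cls k = i}) :
    contractRight (L i) (e i k) ∘ₗ isometryComponent e J u i =
      LinearMap.adjoint (J i) ∘ₗ LinearMap.adjoint (u k) := by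
  rw [isometryComponent, comp_sum, Finset.sum_eq_single k]
  · refine LinearMap.ext fun x => ?_
    simp
  · intro l _ hl
    refine LinearMap.ext fun x => ?_
    simp [(e i).inner_eq_zero hl.symm]
  · simp

/-- The isometries `u_k Jᵢ` identify `H` with `⨁ᵢ Lᵢ ⊗ Rᵢ`. The operators in the commutant of the
algebra of all intertwiners `u_k c u_l†` are exactly those of the form `⨁ᵢ bᵢ ⊗ 1`; by the double
commutant theorem they form the algebra `B`. -/
lemma exists_isRepresentationUnitary (B : StarSubalgebra ℂ (H →ₗ[ℂ] H))
    (e : ∀ i, OrthonormalBasis {k // cls k = i} ℂ (R i)) (J : ∀ i, L i →ₗ[ℂ] H)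
    (u : ι → H →ₗ[ℂ] H) {q : Fin n → H →ₗ[ℂ] H}
    (hJ : ∀ i, LinearMap.adjoint (J i) ∘ₗ J i = LinearMap.id)
    (hJq : ∀ i, J i ∘ₗ LinearMap.adjoint (J i) = q i)
    (hq : ∀ i, IsMinimalProjection (commutant B) (q i)) (hu : ∀ k, u k ∈ commutant B)
    (huq : ∀ k, star (u k) * u k = q (cls k)) (hul : ∀ k l, k ≠ l → star (u k) * u l = 0)
    (hsum : ∑ k, u k * star (u k) = 1)
    (hcls : ∀ c ∈ commutant B, ∀ k l, cls k ≠ cls l → star (u k) * c * u l = 0) :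
    ∃ U : H ≃ₗᵢ[ℂ] PiLp 2 (fun i => L i ⊗[ℂ] R i), IsRepresentationUnitary B U := by
  have huq' : ∀ k, u k * q (cls k) = u k := fun k =>
    mul_eq_self_of_star_mul_self (huq k) (hq _).isStarProjection
  have hqs : ∀ i, star (q i) = q i := fun i => (hq i).isStarProjection.isSelfAdjoint.star_eq
  have hqu : ∀ k, q (cls k) * star (u k) = star (u k) := fun k => by
    conv_rhs => rw [← huq', star_mul, hqs]
  have hcontract := contractRight_comp_isometryComponent e J u
  have hadj := adjoint_isometryComponent e J u
  -- The `i`-th component maps `u_k Jᵢ l` to `l ⊗ e_k` if `k` is in the class `i`, else to `0`.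
  have hCu : ∀ (i : Fin n) (k : ι), isometryComponent e J u i ∘ₗ u k ∘ₗ J (cls k) =
      if h : cls k = i then insertRight (L i) (e i ⟨k, h⟩) ∘ₗ LinearMap.adjoint (J i) ∘ₗ
        J (cls k) else 0 := by
    intro i k
    simp only [isometryComponent, sum_comp, LinearMap.comp_assoc]
    have hne : ∀ l : {k // cls k = i}, (l : ι) ≠ k →
        LinearMap.adjoint (u l) ∘ₗ u k ∘ₗ J (cls k) = 0 := fun l hl => by
      rw [← LinearMap.comp_assoc]
      exact (congrArg (· ∘ₗ J (cls k)) (hul _ _ hl)).trans (LinearMap.zero_comp _)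
    split_ifs with h
    · rw [Finset.sum_eq_single ⟨k, h⟩]
      · have : LinearMap.adjoint (u k) ∘ₗ u k ∘ₗ J (cls k) = J (cls k) := by
          rw [← LinearMap.comp_assoc]
          refine (congrArg (· ∘ₗ J (cls k)) (huq k)).trans ?_
          simp only [← hJq, LinearMap.comp_assoc, hJ, LinearMap.comp_id]
        rw [this]
      · intro l _ hl
        rw [hne l fun h' => hl (Subtype.ext h'), LinearMap.comp_zero, LinearMap.comp_zero]
      · simp
    · refine Finset.sum_eq_zero fun l _ => ?_
      rw [hne l fun h' => h (h' ▸ l.2), LinearMap.comp_zero, LinearMap.comp_zero]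
  obtain ⟨U, hU⟩ := exists_unitary_of_components (isometryComponent e J u)
    (by
      intro i
      rw [hadj, comp_sum, ← LinearMap.lTensor_id, ← sum_ketBra_self (e i), lTensor_sum]
      refine Finset.sum_congr rfl fun k _ => ?_
      obtain ⟨k, rfl⟩ := k
      have h := hCu (cls k) k
      rw [dif_pos rfl, hJ, LinearMap.comp_id] at h
      rw [← insertRight_comp_contractRight, ← h, LinearMap.comp_assoc, LinearMap.comp_assoc])
    (by
      intro i j hij
      rw [hadj, comp_sum]
      refine Finset.sum_eq_zero fun k _ => ?_
      obtain ⟨k, rfl⟩ := k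
      have h := hCu i k
      rw [dif_neg hij.symm] at h
      change isometryComponent e J u i ∘ₗ u k ∘ₗ J (cls k) ∘ₗ contractRight _ _ = 0
      rw [← LinearMap.comp_assoc _ (J (cls k)) (u k),
        ← LinearMap.comp_assoc _ _ (isometryComponent e J u i), h, LinearMap.zero_comp])
    (by
      have h1 : ∀ i, LinearMap.adjoint (isometryComponent e J u i) ∘ₗ isometryComponent e J u i =
          ∑ k : {k // cls k = i}, u k * star (u k) := by
        intro i
        rw [hadj, sum_comp]
        refine Finset.sum_congr rfl fun k _ => ?_
        rw [LinearMap.comp_assoc, LinearMap.comp_assoc, hcontract, ← LinearMap.comp_assoc _ _ (J i),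
          hJq]
        obtain ⟨k, rfl⟩ := k
        exact congrArg (u k * ·) (hqu k)
      simp only [h1]
      rw [← Fintype.sum_sigma']
      exact (Equiv.sum_comp (Equiv.sigmaFiberEquiv cls) fun k => u k * star (u k)).trans hsum)
  refine ⟨U, fun a => ?_⟩
  simp only [hU]
  constructor
  · intro ha
    refine ⟨fun i => LinearMap.adjoint (J i) ∘ₗ a ∘ₗ J i, fun x i => ?_⟩
    simp only [isometryComponent, LinearMap.sum_apply, map_sum]
    refine Finset.sum_congr rfl fun k _ => ?_
    obtain ⟨k, rfl⟩ := k
    simp only [LinearMap.comp_apply, insertRight_apply, LinearMap.rTensor_tmul]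
    congr 1
    have h1 : star (u k) * a = a * q (cls k) * star (u k) := by
      rw [mul_assoc, hqu]
      exact (mem_commutant_iff.1 (star_mem (hu k)) a ha).symm
    have h2 := LinearMap.congr_fun h1 x
    rw [← hJq] at h2
    exact congrArg _ h2
  · rintro ⟨b, hb⟩
    have hb' : ∀ i, isometryComponent e J u i ∘ₗ a =
        LinearMap.rTensor (R i) (b i) ∘ₗ isometryComponent e J u i := fun i =>
      LinearMap.ext fun x => hb x i
    -- The operators `b̂ᵢ = Jᵢ bᵢ Jᵢ†` satisfy `a u_k = u_k b̂ᵢ` and `u_k† a = b̂ᵢ u_k†`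
    -- for `k` in the class `i`.
    let b' : Fin n → H →ₗ[ℂ] H := fun i => J i ∘ₗ b i ∘ₗ LinearMap.adjoint (J i)
    have hqb : ∀ i, q i * b' i = b' i := fun i => by
      change q i ∘ₗ J i ∘ₗ b i ∘ₗ LinearMap.adjoint (J i) = J i ∘ₗ b i ∘ₗ LinearMap.adjoint (J i)
      rw [← hJq, LinearMap.comp_assoc, ← LinearMap.comp_assoc _ _ (LinearMap.adjoint (J i)), hJ,
        LinearMap.id_comp]
    have hbq : ∀ i, b' i * q i = b' i := fun i => by
      change (J i ∘ₗ b i ∘ₗ LinearMap.adjoint (J i)) ∘ₗ q i = J i ∘ₗ b i ∘ₗ LinearMap.adjoint (J i)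
      rw [← hJq, LinearMap.comp_assoc, LinearMap.comp_assoc, ← LinearMap.comp_assoc _ (J i), hJ,
        LinearMap.id_comp]
    have hua : ∀ k, star (u k) * a = b' (cls k) * star (u k) := by
      intro k
      have h1 := congrArg (fun f => contractRight (L (cls k)) (e (cls k) ⟨k, rfl⟩) ∘ₗ f)
        (hb' (cls k))
      have h2 : ∀ (f : L (cls k) →ₗ[ℂ] L (cls k)) (r : R (cls k)),
          contractRight (L (cls k)) r ∘ₗ LinearMap.rTensor (R (cls k)) f =
            f ∘ₗ contractRight (L (cls k)) r := fun f r =>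
        TensorProduct.ext' fun x y => by simp
      simp only [← LinearMap.comp_assoc, h2] at h1
      rw [hcontract, LinearMap.comp_assoc _ _ (b _), hcontract] at h1
      have h3 := congrArg (fun f => J (cls k) ∘ₗ f) h1
      simp only [← LinearMap.comp_assoc, hJq] at h3
      calc star (u k) * a = q (cls k) * star (u k) * a := by rw [hqu]
        _ = b' (cls k) * star (u k) := h3
    have hau : ∀ k, a * u k = u k * b' (cls k) := by
      intro k
      calc a * u k = (∑ l, u l * star (u l)) * a * u k := by rw [hsum, one_mul]
        _ = ∑ l, u l * (b' (cls l) * (star (u l) * u k)) := by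
          rw [Finset.sum_mul, Finset.sum_mul]
          refine Finset.sum_congr rfl fun l _ => ?_
          rw [mul_assoc (u l), hua, mul_assoc, mul_assoc]
        _ = u k * b' (cls k) := by
          rw [Finset.sum_eq_single k]
          · rw [huq, hbq]
          · intro l _ hl
            rw [hul l k hl, mul_zero, mul_zero]
          · simp
    rw [← commutant_commutant B]
    refine mem_commutant_iff.2 fun c hc => ?_
    -- Within a class `u_k† c u_l` is a multiple of the minimal projection `qᵢ`, which acts as the
    -- unit on `b̂ᵢ`; between different classes it is zero.
    have hkl : ∀ k l, star (u k) * (c * a) * u l = star (u k) * (a * c) * u l := by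
      intro k l
      have h1 : star (u k) * (c * a) * u l = star (u k) * c * u l * b' (cls l) := by
        simp only [mul_assoc, hau]
      have h2 : star (u k) * (a * c) * u l = b' (cls k) * (star (u k) * c * u l) := by
        rw [← mul_assoc, hua]
        simp only [mul_assoc]
      rw [h1, h2]
      by_cases h : cls k = cls l
      · obtain ⟨z, hz⟩ := (hq (cls l)).minimal (star (u k) * c * u l)
          (mul_mem (mul_mem (star_mem (hu k)) hc) (hu l))
        have h3 : star (u k) * c * u l = z • q (cls l) := by
          rw [← hz]
          simp only [mul_assoc, huq']
          rw [← mul_assoc (q _), ← h, hqu]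
        rw [h3, h, smul_mul_assoc, mul_smul_comm, hqb, hbq]
      · rw [hcls c hc k l h, zero_mul, mul_zero]
    -- The operators `u_k u_k†` sum to `1`, so `d` is determined by the blocks `u_k† d u_l`.
    have hexp : ∀ d : H →ₗ[ℂ] H, d = ∑ k, ∑ l, u k * (star (u k) * d * u l) * star (u l) := by
      intro d
      calc d = (∑ k, u k * star (u k)) * d * ∑ l, u l * star (u l) := by
            rw [hsum, one_mul, mul_one]
        _ = _ := by
          rw [Finset.sum_mul, Finset.sum_mul_sum]
          simp only [mul_assoc]
    rw [hexp (c * a), hexp (a * c)]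
    simp only [hkl]

/-- Every unital *-subalgebra of `𝓛(H)` has a representation unitary. -/
theorem nonempty_representationUnitary (B : StarSubalgebra ℂ (H →ₗ[ℂ] H)) :
    Nonempty (RepresentationUnitary B) := by
  obtain ⟨ι, _, n, cls, q, u, hsurj, hq, hu, huq, hul, hsum, hcls⟩ := exists_partialIsometries B
  choose d J hJ hJq using fun i => exists_isometry_of_isStarProjection (hq i).isStarProjection
  obtain ⟨U, hU⟩ := exists_isRepresentationUnitary (cls := cls)
    (L := fun i => EuclideanSpace ℂ (Fin (d i)))
    (R := fun i => EuclideanSpace ℂ {k // cls k = i}) B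
    (fun i => EuclideanSpace.basisFun _ ℂ) J u hJ hJq hq hu huq hul hsum hcls
  have hL : ∀ i, Nontrivial (EuclideanSpace ℂ (Fin (d i))) := fun i => by
    by_contra h
    rw [not_nontrivial_iff_subsingleton] at h
    refine (hq i).ne_zero ?_
    rw [← hJq, Subsingleton.elim (J i) 0, LinearMap.zero_comp]
  have hR : ∀ i, Nontrivial (EuclideanSpace ℂ {k // cls k = i}) := fun i => by
    obtain ⟨k, hk⟩ := hsurj i
    have : Nonempty {k // cls k = i} := ⟨⟨k, hk⟩⟩
    infer_instance
  exact ⟨{ blocks := n, L := _, R := _, U := U, isRepresentation := hU }⟩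

end Existence

/-! ### Semi-localisable channels in the Heisenberg picture -/

section Heisenberg

variable {H : Type*} [NormedAddCommGroup H] [InnerProductSpace ℂ H] [FiniteDimensional ℂ H]
  {K : Type*} [NormedAddCommGroup K] [InnerProductSpace ℂ K] [FiniteDimensional ℂ K]
  {S : Type*} [NormedAddCommGroup S] [InnerProductSpace ℂ S] [FiniteDimensional ℂ S]

lemma trace_comp_actLeft (E : (H →ₗ[ℂ] H) →ₗ[ℂ] (K →ₗ[ℂ] K)) {b : K →ₗ[ℂ] K} {c : H →ₗ[ℂ] H}
    (h : ∀ ρ, LinearMap.trace ℂ K (b ∘ₗ E ρ) = LinearMap.trace ℂ H (c ∘ₗ ρ))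
    (X : (H ⊗[ℂ] S) →ₗ[ℂ] (H ⊗[ℂ] S)) :
    LinearMap.trace ℂ (K ⊗[ℂ] S) (LinearMap.rTensor S b ∘ₗ actLeft S E X) =
      LinearMap.trace ℂ (H ⊗[ℂ] S) (LinearMap.rTensor S c ∘ₗ X) := by
  obtain ⟨z, rfl⟩ := (homTensorHomEquiv ℂ H S H S).surjective X
  induction z with
  | zero => simp
  | add z w hz hw => simp only [map_add, LinearMap.comp_add, hz, hw]
  | tmul f g =>
    simp only [actLeft, LinearMap.comp_apply, LinearEquiv.coe_coe, LinearEquiv.symm_apply_apply]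
    simp [LinearMap.rTensor_comp_map, LinearMap.trace_tensorProduct', h]

lemma trace_comp_actRight (E : (H →ₗ[ℂ] H) →ₗ[ℂ] (K →ₗ[ℂ] K))
    (hE : ∀ ρ, LinearMap.trace ℂ K (E ρ) = LinearMap.trace ℂ H ρ) (b : S →ₗ[ℂ] S)
    (X : (S ⊗[ℂ] H) →ₗ[ℂ] (S ⊗[ℂ] H)) :
    LinearMap.trace ℂ (S ⊗[ℂ] K) (LinearMap.rTensor K b ∘ₗ actRight S E X) =
      LinearMap.trace ℂ (S ⊗[ℂ] H) (LinearMap.rTensor H b ∘ₗ X) := by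
  obtain ⟨z, rfl⟩ := (homTensorHomEquiv ℂ S H S H).surjective X
  induction z with
  | zero => simp
  | add z w hz hw => simp only [map_add, LinearMap.comp_add, hz, hw]
  | tmul f g =>
    simp only [actRight, LinearMap.comp_apply, LinearEquiv.coe_coe, LinearEquiv.symm_apply_apply]
    simp [LinearMap.rTensor_comp_map, LinearMap.trace_tensorProduct', hE]

variable {L R L' R' M : Type}
  [NormedAddCommGroup L] [InnerProductSpace ℂ L] [FiniteDimensional ℂ L]
  [NormedAddCommGroup R] [InnerProductSpace ℂ R] [FiniteDimensional ℂ R]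
  [NormedAddCommGroup L'] [InnerProductSpace ℂ L'] [FiniteDimensional ℂ L']
  [NormedAddCommGroup R'] [InnerProductSpace ℂ R'] [FiniteDimensional ℂ R']
  [NormedAddCommGroup M] [InnerProductSpace ℂ M] [FiniteDimensional ℂ M]

lemma trace_comp_assoc_conj (b : L' →ₗ[ℂ] L')
    (X : ((L' ⊗[ℂ] M) ⊗[ℂ] R) →ₗ[ℂ] ((L' ⊗[ℂ] M) ⊗[ℂ] R)) :
    LinearMap.trace ℂ (L' ⊗[ℂ] (M ⊗[ℂ] R)) (LinearMap.rTensor (M ⊗[ℂ] R) b ∘ₗ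
      (TensorProduct.assoc ℂ L' M R).conj X) =
      LinearMap.trace ℂ ((L' ⊗[ℂ] M) ⊗[ℂ] R)
        (LinearMap.rTensor R (LinearMap.rTensor M b) ∘ₗ X) := by
  rw [← LinearMap.trace_conj' (LinearMap.rTensor R (LinearMap.rTensor M b) ∘ₗ X)
    (TensorProduct.assoc ℂ L' M R), LinearEquiv.conj_comp]
  congr 2
  exact TensorProduct.ext' fun x y => by
    induction y with
    | zero => simp
    | add y z hy hz => simp only [TensorProduct.tmul_add, map_add, hy, hz]
    | tmul y z => simp [LinearEquiv.conj_apply]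

/-- The second step of a sequential composition acts on the right factor only and preserves the
trace, so it does not affect the expectation values of left-local operators. -/
lemma exists_trace_comp_sequential
    (E₁ : (L →ₗ[ℂ] L) →ₗ[ℂ] ((L' ⊗[ℂ] M) →ₗ[ℂ] (L' ⊗[ℂ] M)))
    {E₂ : ((M ⊗[ℂ] R) →ₗ[ℂ] (M ⊗[ℂ] R)) →ₗ[ℂ] (R' →ₗ[ℂ] R')} (hE₂ : IsChannel E₂)
    (b : L' →ₗ[ℂ] L') :
    ∃ c : L →ₗ[ℂ] L, ∀ X,
      LinearMap.trace ℂ (L' ⊗[ℂ] R') (LinearMap.rTensor R' b ∘ₗ sequential E₁ E₂ X) =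
        LinearMap.trace ℂ (L ⊗[ℂ] R) (LinearMap.rTensor R c ∘ₗ X) := by
  obtain ⟨c, hc⟩ := exists_trace_comp_eq
    (LinearMap.trace ℂ (L' ⊗[ℂ] M) ∘ₗ LinearMap.mulLeft ℂ (LinearMap.rTensor M b) ∘ₗ E₁)
  refine ⟨c, fun X => ?_⟩
  rw [sequential, LinearMap.comp_apply, trace_comp_actRight _ hE₂.trace_preserving]
  exact (trace_comp_assoc_conj b _).trans (trace_comp_actLeft E₁ (fun ρ => (hc ρ).symm) X)

/-- The Heisenberg dual of a semi-localisable channel maps left-local operators of `ζ` to operators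
`χ† (c ⊗ 1) χ`, which commute with the right-local operators of `χ`. -/
lemma IsSemiLocalisable.exists_trace_comp_eq {E : (H →ₗ[ℂ] H) →ₗ[ℂ] (K →ₗ[ℂ] K)}
    {χ : H →ₗᵢ[ℂ] L ⊗[ℂ] R} {ζ : K →ₗᵢ[ℂ] L' ⊗[ℂ] R'} (h : IsSemiLocalisable E χ ζ)
    {b : K →ₗ[ℂ] K} (hb : b ∈ stlocL ζ) :
    ∃ c ∈ Set.centralizer (stlocR χ),
      ∀ ρ, LinearMap.trace ℂ K (b ∘ₗ E ρ) = LinearMap.trace ℂ H (c ∘ₗ ρ) := by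
  obtain ⟨M, _, _, _, E₁, E₂, -, hE₂, hE, himage⟩ := h
  obtain ⟨b', -, hb'⟩ := hb
  obtain ⟨c, hc⟩ := exists_trace_comp_sequential (R := R) E₁ hE₂ b'
  generalize sequential E₁ E₂ = G at hE himage hc
  refine ⟨dagger χ ∘ₗ LinearMap.rTensor R c ∘ₗ χ.toLinearMap, ?_, fun ρ => ?_⟩
  · rintro a ⟨d, had, hda⟩
    change a ∘ₗ dagger χ ∘ₗ LinearMap.rTensor R c ∘ₗ χ.toLinearMap =
      (dagger χ ∘ₗ LinearMap.rTensor R c ∘ₗ χ.toLinearMap) ∘ₗ a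
    rw [LinearMap.comp_assoc, LinearMap.comp_assoc, hda, ← LinearMap.comp_assoc _ _ a, had,
      LinearMap.comp_assoc, ← LinearMap.comp_assoc _ _ (LinearMap.lTensor L d),
      ← LinearMap.comp_assoc _ _ (LinearMap.rTensor R c), LinearMap.rTensor_comp_lTensor,
      LinearMap.lTensor_comp_rTensor]
  · obtain ⟨F, hF⟩ : ∃ F, F = G (conj χ.toLinearMap ρ) := ⟨_, rfl⟩
    have hπ : imageProj ζ ∘ₗ F = F := by
      have h1 : conj (imageProj ζ) F = F := by
        rw [hF]
        exact LinearMap.congr_fun himage ρ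
      have h2 : imageProj ζ ∘ₗ imageProj ζ = imageProj ζ := by
        rw [imageProj, LinearMap.comp_assoc, ← LinearMap.comp_assoc _ _ (dagger ζ), dagger_comp,
          LinearMap.id_comp]
      calc imageProj ζ ∘ₗ F = imageProj ζ ∘ₗ conj (imageProj ζ) F := by rw [h1]
        _ = conj (imageProj ζ) F := by rw [conj_apply, ← LinearMap.comp_assoc, h2]
        _ = F := h1
    have hEρ : E ρ = dagger ζ ∘ₗ F ∘ₗ ζ.toLinearMap := by
      rw [hE, LinearMap.comp_apply, LinearMap.comp_apply, ← hF, conj_apply, dagger,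
        LinearMap.adjoint_adjoint]
    calc LinearMap.trace ℂ K (b ∘ₗ E ρ)
        = LinearMap.trace ℂ K ((b ∘ₗ dagger ζ ∘ₗ F) ∘ₗ ζ.toLinearMap) := by
          rw [hEρ, LinearMap.comp_assoc, LinearMap.comp_assoc]
      _ = LinearMap.trace ℂ (L' ⊗[ℂ] R') (LinearMap.rTensor R' b' ∘ₗ imageProj ζ ∘ₗ F) := by
          rw [LinearMap.trace_comp_comm', ← LinearMap.comp_assoc, hb', LinearMap.comp_assoc,
            imageProj, LinearMap.comp_assoc]
      _ = LinearMap.trace ℂ (L ⊗[ℂ] R) (LinearMap.rTensor R c ∘ₗ conj χ.toLinearMap ρ) := by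
          rw [hπ, hF, hc]
      _ = _ := trace_conj _ _ _

end Heisenberg

/-! ### From the Heisenberg condition to semi-causality -/

section SemiCausal

variable {H : Type*} [NormedAddCommGroup H] [InnerProductSpace ℂ H] [FiniteDimensional ℂ H]
  {K : Type*} [NormedAddCommGroup K] [InnerProductSpace ℂ K] [FiniteDimensional ℂ K]
  {n : ℕ} {L R : Fin n → Type}
  [∀ i, NormedAddCommGroup (L i)] [∀ i, InnerProductSpace ℂ (L i)]
  [∀ i, FiniteDimensional ℂ (L i)]
  [∀ i, NormedAddCommGroup (R i)] [∀ i, InnerProductSpace ℂ (R i)]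
  [∀ i, FiniteDimensional ℂ (R i)]
  (U : H ≃ₗᵢ[ℂ] PiLp 2 (fun i => L i ⊗[ℂ] R i))

/-- The map `⨁ᵢ 𝓛(Lᵢ) → 𝓛(H)`, `⨁ᵢ ρᵢ ↦ U† (⨁ᵢ ρᵢ ⊗ |rᵢ⟩⟨rᵢ|) U`. For unit vectors `rᵢ` it is a
right inverse of the partial trace. -/
def prepare (r : ∀ i, R i) : (∀ i, L i →ₗ[ℂ] L i) →ₗ[ℂ] (H →ₗ[ℂ] H) :=
  ∑ i, conj (LinearMap.adjoint (component U i) ∘ₗ insertRight (L i) (r i)) ∘ₗ LinearMap.proj i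

lemma trace_blockOp_comp_prepare {r : ∀ i, R i} (hr : ∀ i, ‖r i‖ = 1) (c : ∀ i, L i →ₗ[ℂ] L i)
    (ρ : ∀ i, L i →ₗ[ℂ] L i) :
    LinearMap.trace ℂ H (blockOp U c ∘ₗ prepare U r ρ) =
      ∑ i, LinearMap.trace ℂ (L i) (c i ∘ₗ ρ i) := by
  simp only [prepare, LinearMap.sum_apply, LinearMap.comp_apply, LinearMap.proj_apply, comp_sum,
    map_sum, trace_conj]
  refine Finset.sum_congr rfl fun i _ => ?_
  congr 2
  rw [LinearMap.adjoint_comp, LinearMap.adjoint_adjoint, adjoint_insertRight,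
    LinearMap.comp_assoc, ← LinearMap.comp_assoc _ (blockOp U c), component_comp_blockOp,
    ← LinearMap.comp_assoc _ _ (_ ∘ₗ component U i), LinearMap.comp_assoc _ (component U i),
    component_comp_adjoint, LinearMap.comp_id]
  refine LinearMap.ext fun l => ?_
  simp [inner_self_eq_norm_sq_to_K, hr]

lemma blockPositive_prepare (r : ∀ i, R i) {k : ℕ}
    {T : Matrix (Fin k) (Fin k) (∀ i, L i →ₗ[ℂ] L i)}
    (hT : ∀ i, BlockPositive (T.map fun t => t i)) : BlockPositive (T.map (prepare U r)) := by
  have h : T.map (prepare U r) = ∑ i, (T.map fun t => t i).map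
      (conj (LinearMap.adjoint (component U i) ∘ₗ insertRight (L i) (r i))) := by
    ext a b : 2
    simp [Matrix.sum_apply, prepare]
  rw [h]
  exact BlockPositive.sum _ fun i _ => (hT i).conj _

lemma blockPositive_traceCommutant {k : ℕ} {T : Matrix (Fin k) (Fin k) (H →ₗ[ℂ] H)}
    (hT : BlockPositive T) (i : Fin n) : BlockPositive (T.map fun t => traceCommutant U t i) := by
  have h := isCompletelyPositive_sum_conj
    (fun k => contractRight (L i) (stdOrthonormalBasis ℂ (R i) k)) _ _
    (hT.conj (component U i))
  rw [← traceRight_eq_sum_conj] at h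
  convert h using 1
  ext a b : 2
  simp [traceCommutant_apply]

/-- If the Heisenberg dual of `E` maps `B` into the commutant of `A`, then `E` is semi-causal: the
channel `Tr_{B'} ∘ E ∘ σ`, where `σ` is a right inverse of the trace over `A`, is a suitable `E'`,
as `ρ` and `σ (Tr_A ρ)` give the same expectation values for the operators of `A'`. -/
theorem isSemiCausal_of_exists_trace_comp_eq {E : (H →ₗ[ℂ] H) →ₗ[ℂ] (K →ₗ[ℂ] K)}
    (hE : IsChannel E) {A : StarSubalgebra ℂ (H →ₗ[ℂ] H)} {B : StarSubalgebra ℂ (K →ₗ[ℂ] K)}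
    (h : ∀ b ∈ B, ∃ c ∈ commutant A,
      ∀ ρ, LinearMap.trace ℂ K (b ∘ₗ E ρ) = LinearMap.trace ℂ H (c ∘ₗ ρ)) :
    IsSemiCausal E A B := by
  obtain ⟨r⟩ := nonempty_representationUnitary (commutant A)
  obtain ⟨s⟩ := nonempty_representationUnitary B
  choose t ht using fun i => exists_norm_eq (r.R i) zero_le_one
  refine ⟨r, s, traceCommutant s.U ∘ₗ E ∘ₗ prepare r.U t, ⟨fun k T hT j => ?_, fun ρ => ?_⟩, ?_⟩
  · exact blockPositive_traceCommutant s.U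
      (hE.completelyPositive k _ (blockPositive_prepare r.U t hT)) j
  · have h1 := trace_comp_traceCommutant s.U (fun _ => LinearMap.id) (E (prepare r.U t ρ))
    have h2 := trace_blockOp_comp_prepare r.U ht (fun _ => LinearMap.id) ρ
    simp only [blockOp_one, LinearMap.id_comp, hE.trace_preserving] at h1 h2
    exact h1.trans h2
  · refine LinearMap.ext fun ρ => ?_
    have key : ∀ b : ∀ j, s.L j →ₗ[ℂ] s.L j,
        ∑ j, LinearMap.trace ℂ (s.L j) (b j ∘ₗ traceCommutant s.U (E ρ) j) =
        ∑ j, LinearMap.trace ℂ (s.L j)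
          (b j ∘ₗ traceCommutant s.U (E (prepare r.U t (traceCommutant r.U ρ))) j) := by
      intro b
      obtain ⟨c, hc, hbc⟩ := h (blockOp s.U b) (s.isRepresentation.mem_iff.2 ⟨b, rfl⟩)
      obtain ⟨c, rfl⟩ := r.isRepresentation.mem_iff.1 hc
      rw [trace_comp_traceCommutant, trace_comp_traceCommutant, hbc, hbc,
        trace_blockOp_comp_prepare r.U ht, trace_comp_traceCommutant]
    refine funext fun j => eq_of_trace_comp_eq fun b => ?_
    have := key (Pi.single j b)
    rw [Finset.sum_eq_single j, Finset.sum_eq_single j] at this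
    · rw [LinearMap.trace_comp_comm' b, LinearMap.trace_comp_comm' b]
      simpa using this
    all_goals simp +contextual [Pi.single_eq_of_ne]

end SemiCausal

/-! ### The equivalence -/

section Equivalence

variable {H : Type*} [NormedAddCommGroup H] [InnerProductSpace ℂ H] [FiniteDimensional ℂ H]
  {K : Type*} [NormedAddCommGroup K] [InnerProductSpace ℂ K] [FiniteDimensional ℂ K]
  {n : ℕ} {L R : Fin n → Type}
  [∀ i, NormedAddCommGroup (L i)] [∀ i, InnerProductSpace ℂ (L i)]
  [∀ i, FiniteDimensional ℂ (L i)]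
  [∀ i, NormedAddCommGroup (R i)] [∀ i, InnerProductSpace ℂ (R i)]
  [∀ i, FiniteDimensional ℂ (R i)]

lemma dagger_comp_rTensor_comp_splitting (U : H ≃ₗᵢ[ℂ] PiLp 2 (fun i => L i ⊗[ℂ] R i))
    (b : PiLp 2 L →ₗ[ℂ] PiLp 2 L) :
    dagger (splitting U) ∘ₗ LinearMap.rTensor (PiLp 2 R) b ∘ₗ (splitting U).toLinearMap =
      blockOp U (fun i => proj L i ∘ₗ b ∘ₗ incl L i) := by
  rw [dagger_splitting, toLinearMap_splitting, splittingOp, blockOp, sum_comp]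
  refine Finset.sum_congr rfl fun i _ => ?_
  simp only [comp_sum]
  rw [Finset.sum_eq_single i]
  · have : TensorProduct.map (proj L i) (proj R i) ∘ₗ LinearMap.rTensor (PiLp 2 R) b ∘ₗ
        TensorProduct.map (incl L i) (incl R i) =
          LinearMap.rTensor (R i) (proj L i ∘ₗ b ∘ₗ incl L i) := TensorProduct.ext' fun l s => by
      simp
    rw [← this]
    simp only [LinearMap.comp_assoc]
  · intro j _ hj
    refine LinearMap.ext fun x => ?_
    have : TensorProduct.map (proj L i) (proj R i) ∘ₗ LinearMap.rTensor (PiLp 2 R) b ∘ₗ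
        TensorProduct.map (incl L j) (incl R j) = 0 := TensorProduct.ext' fun l s => by
      simp [hj]
    have := congrArg (LinearMap.adjoint (component U i))
      (LinearMap.congr_fun this (component U j x))
    simpa using this
  · simp

theorem IsSemiCausal.exists_isSemiLocalisable {E : (H →ₗ[ℂ] H) →ₗ[ℂ] (K →ₗ[ℂ] K)}
    (hE : IsChannel E) {A : StarSubalgebra ℂ (H →ₗ[ℂ] H)} {B : StarSubalgebra ℂ (K →ₗ[ℂ] K)}
    (h : IsSemiCausal E A B) :
    ∃ (χ : SplittingMap H) (ζ : SplittingMap K), IsLeanSplitting χ.map ∧ IsLeanSplitting ζ.map ∧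
      Represents χ.map (commutant A) ∧ Represents ζ.map B ∧
      IsSemiLocalisable E χ.map ζ.map := by
  obtain ⟨r, s, E', -, hcomm⟩ := h
  obtain ⟨N, V, rfl⟩ := hE.completelyPositive.exists_kraus
  refine ⟨{ L := PiLp 2 r.L, R := PiLp 2 r.R, map := splitting r.U },
    { L := PiLp 2 s.L, R := PiLp 2 s.R, map := splitting s.U }, isLeanSplitting_splitting _,
    isLeanSplitting_splitting _, represents_splitting r.isRepresentation,
    represents_splitting s.isRepresentation,
    isSemiLocalisable_of_adjoint r.U _ V hE.sum_adjoint_comp fun b => ?_⟩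
  rw [dagger_comp_rTensor_comp_splitting]
  exact exists_sum_adjoint_comp_blockOp r.U s.U V E' hcomm _

theorem IsSemiLocalisable.isSemiCausal {L R L' R' : Type}
    [NormedAddCommGroup L] [InnerProductSpace ℂ L] [FiniteDimensional ℂ L]
    [NormedAddCommGroup R] [InnerProductSpace ℂ R] [FiniteDimensional ℂ R]
    [NormedAddCommGroup L'] [InnerProductSpace ℂ L'] [FiniteDimensional ℂ L']
    [NormedAddCommGroup R'] [InnerProductSpace ℂ R'] [FiniteDimensional ℂ R']
    {E : (H →ₗ[ℂ] H) →ₗ[ℂ] (K →ₗ[ℂ] K)}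
    (hE : IsChannel E) {A : StarSubalgebra ℂ (H →ₗ[ℂ] H)} {B : StarSubalgebra ℂ (K →ₗ[ℂ] K)}
    {χ : H →ₗᵢ[ℂ] L ⊗[ℂ] R} {ζ : K →ₗᵢ[ℂ] L' ⊗[ℂ] R'} (hχ : IsBalanced χ)
    (hχA : Represents χ (commutant A)) (hζB : Represents ζ B) (h : IsSemiLocalisable E χ ζ) :
    IsSemiCausal E A B := by
  refine isSemiCausal_of_exists_trace_comp_eq hE fun b hb => ?_
  obtain ⟨c, hc, hbc⟩ := h.exists_trace_comp_eq (hζB.symm ▸ hb : b ∈ stlocL ζ)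
  refine ⟨c, mem_commutant_iff.2 fun a ha => hc a ?_, hbc⟩
  -- By balance `StLoc_R(χ)` is the commutant of `A'`, which contains `A`.
  rw [hχ, hχA]
  exact fun d hd => (mem_commutant_iff.1 hd a ha).symm

end Equivalence

end SplittingMaps

end

theorem mainTheorem2
    {H : Type*} [NormedAddCommGroup H] [InnerProductSpace ℂ H] [FiniteDimensional ℂ H]
    {K : Type*} [NormedAddCommGroup K] [InnerProductSpace ℂ K] [FiniteDimensional ℂ K]
    (A : StarSubalgebra ℂ (H →ₗ[ℂ] H)) (B : StarSubalgebra ℂ (K →ₗ[ℂ] K))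
    (E : (H →ₗ[ℂ] H) →ₗ[ℂ] (K →ₗ[ℂ] K)) (hE : SplittingMaps.IsChannel E) :
    SplittingMaps.IsSemiCausal E A B ↔
      ∃ (χ : SplittingMaps.SplittingMap H) (ζ : SplittingMaps.SplittingMap K),
        SplittingMaps.IsLeanSplitting χ.map ∧ SplittingMaps.IsLeanSplitting ζ.map ∧
          SplittingMaps.Represents χ.map (SplittingMaps.commutant A) ∧
          SplittingMaps.Represents ζ.map B ∧
          SplittingMaps.IsSemiLocalisable E χ.map ζ.map := by
  refine ⟨fun h => h.exists_isSemiLocalisable hE, ?_⟩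
  rintro ⟨χ, ζ, hχ, -, hχA, hζB, h⟩
  exact h.isSemiCausal hE hχ.balanced hχA hζB
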